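/- **Algebras.** For an index set $I$, a modal substitution algebra of dimension $I$ is a Boolean algebra with unary operations $\square$, $\mathsf c_i$, $\mathsf s_i^j$ ($i,j\in I$) satisfying, for all $i,j,k,l\in I$: $\square 1=1$; $\square(-x\vee y)\le -\square x\vee\square y$; $\mathsf c_j0=0$; $x\le \mathsf c_ix$; $\mathsf c_i(x\wedge \mathsf c_iy)=\mathsf c_ix\wedge \mathsf c_iy$; $\mathsf c_i(x\vee y)=\mathsf c_ix\vee \mathsf c_iy$; $\mathsf c_i\mathsf c_jx=\mathsf c_j\mathsf c_ix$; $\mathsf s_i^ix=x$; each $\mathsf s_i^j$ is a Boolean endomorphism that commutes with $\square$; $\mathsf s_j^i\mathsf c_ix=\mathsf c_ix$; $\mathsf c_i\mathsf s_j^ix=\mathsf s_j^ix$ if $i\ne j$; $\mathsf s_j^i\mathsf c_kx=\mathsf c_k\mathsf s_j^ix$ if $k\notin\{i,j\}$; $\mathsf c_i\mathsf s_i^jx=\mathsf c_j\mathsf s_j^ix$; $\mathsf s_i^j\mathsf s_k^lx=\mathsf s_k^l\mathsf s_i^jx$ if $i,j,k,l$ are distinct; $\mathsf s_i^l\mathsf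 s_l^jx=\mathsf s_i^l\mathsf s_i^jx$. Put $\Diamond x=-\square-x$, $\mathsf q_ix=-\mathsf c_i-x$, $\Delta x=\{i:\mathsf c_ix\ne x\}$. The algebra is dimension complemented if $I\smallsetminus\Delta x$ is infinite for every $x$. Let $\Lambda$ be a set of axioms among $\Diamond 1=1$ (D), $-\square p\vee p=1$ (T), $-\square p\vee\square\square p=1$ (4). For an ordinal $\gamma$ let $L_\gamma$ be the class of dimension complemented modal substitution algebras of dimension $\gamma$ that validate $\Lambda$. Let $\alpha$ be an infinite ordinal, $\beta$ an ordinal, and $\rho:\beta\to\wp(\alpha)$ such that $\alpha\smallsetminus\bigcup_{\eta\in\Gamma}\rho(\eta)$ is infinite for every finite $\Gamma\subseteq\beta$. For $\gamma\ge\alpha$ let $\mathfrak{Fr}_\beta^\rho L_\gamma$ be the dimension restricted free algebra: the quotient of the absolutely free algebra on generators $\eta<\beta$ by the intersection of all congruences $\theta$ such that the quotient by $\theta$ embeds in a member of $L_\gamma$ and $\mathsf c_k\eta\mathrel\theta\eta$ for all $\eta<\beta$ and $k\notin\rho(\eta)$. Put $A=\mathfrak{Fr}_\beta^\rho L_\alpha$,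 $B_n=\mathfrak{Fr}_\beta^\rho L_{\alpha+\omega\cdot n}$ for $n\in\omega$, and $B_\infty=\mathfrak{Fr}_\beta^\rho L_{\alpha+\omega\cdot\omega}$, with $A\subseteq B_n\subseteq B_\infty$ through the canonical embeddings, which fix the generators. Let $X_1,X_2\subseteq A$ be arbitrary subsets, and let $\mathrm{Sg}^{B}X$ be the subalgebra of $B$ generated by $X$. **Saturated pairs.** Write $\Gamma\to\Gamma'$ if some finite meet of elements of $\Gamma$ is $\le$ some finite join of elements of $\Gamma'$ (empty meet $=1$, empty join $=0$). A pair $(T,F)$ is $(X_1,X_2,B_n)$-saturated if, with $S_i=\mathrm{Sg}^{B_n}X_i$: 1. $T\subseteq S_1$, and $T\to\{a\}$ with $a\in S_1$ implies $a\in T$; $F\subseteq S_2$, and $\{a\}\to F$ with $a\in S_2$ implies $a\in F$; 2. $T\cap F=\emptyset$; 3. for $a,b\in S_1$, $a\vee b\in T$ implies $a\in T$ or $b\in T$; 4. for $a\in S_1$ and $k<\alpha+\omega\cdot n$, $\mathsf c_ka\in T$ implies $\mathsf s_j^ka\in T$ for some $j<\alpha+\omega\cdot n$ with $j\notin\Delta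 a$; 5. for $a,b\in S_2$, $a\wedge b\in F$ implies $a\in F$ or $b\in F$; 6. for $a\in S_2$ and $k<\alpha+\omega\cdot n$, $\mathsf q_ka\in F$ implies $\mathsf s_j^ka\in F$ for some $j<\alpha+\omega\cdot n$ with $j\notin\Delta a$. In 4 and 6, $\Delta a$ is taken in $B_n$. **Canonical Kripke system.** $W$ is the set of pairs $(T,F)$ of subsets of $B_\infty$ that are $(X_1,X_2,B_n)$-saturated for some $n\in\omega$. The least such $n$ is the level of the pair, and $D_{(T,F)}=\alpha+\omega\cdot n$ for that $n$. For $(T,F),(T',F')\in W$ of levels $n,m$, put $(T,F)\,R\,(T',F')$ iff $n\le m$, and $\square a\in T$ implies $a\in T'$ for all $a\in \mathrm{Sg}^{B_n}X_1$, and $\Diamond b\in F$ implies $b\in F'$ for all $b\in\mathrm{Sg}^{B_n}X_2$. **Theorem.** 1. If $\alpha$ and $\beta$ are countable and $A\models\Diamond 1=1$, then $R$ is serial: $\forall x\,\exists y\; xRy$. 2. If $A\models-\square p\vee p=1$, then $R$ is reflexive. 3. If $A\models-\square p\vee\square\square p=1$, then $R$ is transitive. In particular, if (D) $\in\Lambda$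 and $\alpha,\beta$ are countable then $R$ is serial; if (T) $\in\Lambda$ then $R$ is reflexive; if (4) $\in\Lambda$ then $R$ is transitive. This covers the quantified versions of D, T, K4, D4 and S4. -/

import Mathlib

universe u v

namespace QML

/-- A modal algebra: a Boolean algebra with a normal necessity operator `□`. -/
class ModalAlgebra (A : Type v) extends BooleanAlgebra A where
  box : A → A
  box_top : box ⊤ = ⊤
  box_imp : ∀ x y : A, box (xᶜ ⊔ y) ≤ (box x)ᶜ ⊔ box y

/-- Necessity `□ x`. -/
def box {A : Type v} [ModalAlgebra A] (x : A) : A := ModalAlgebra.box x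

/-- Possibility `◇ x = ¬ □ ¬ x`. -/
def dia {A : Type v} [ModalAlgebra A] (x : A) : A := (box xᶜ)ᶜ

/-- The modal axioms `◇⊤`, `□p → p` and `□p → □□p`. Sets of these axioms give the logics
`K`, `D`, `T`, `K4`, `D4`, `S4`. -/
inductive ModalAxiom : Type
  | D
  | T
  | four

/-- Validity of a modal axiom in a modal algebra. -/
def ModalAxiom.Valid (A : Type v) [ModalAlgebra A] : ModalAxiom → Prop
  | .D => dia (⊤ : A) = ⊤
  | .T => ∀ p : A, (box p)ᶜ ⊔ p = ⊤
  | .four => ∀ p : A, (box p)ᶜ ⊔ box (box p) = ⊤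

/-- A modal substitution algebra whose dimension is the index set `I`; `c i` is the
cylindrification `c_i`, and `s i j` is the substitution `s_i^j` (`i` is substituted for `j`). -/
class MSA (I : Type u) (A : Type v) [ModalAlgebra A] where
  c : I → A → A
  s : I → I → A → A
  c_bot : ∀ j, c j ⊥ = ⊥
  le_c : ∀ i x, x ≤ c i x
  c_inf_c : ∀ i x y, c i (x ⊓ c i y) = c i x ⊓ c i y
  c_sup : ∀ i x y, c i (x ⊔ y) = c i x ⊔ c i y
  c_comm : ∀ i j x, c i (c j x) = c j (c i x)
  s_self : ∀ i x, s i i x = x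
  s_sup : ∀ i j x y, s i j (x ⊔ y) = s i j x ⊔ s i j y
  s_inf : ∀ i j x y, s i j (x ⊓ y) = s i j x ⊓ s i j y
  s_compl : ∀ i j x, s i j xᶜ = (s i j x)ᶜ
  s_bot : ∀ i j, s i j ⊥ = ⊥
  s_top : ∀ i j, s i j ⊤ = ⊤
  s_box : ∀ i j x, s i j (box x) = box (s i j x)
  s_c_same : ∀ i j x, s j i (c i x) = c i x
  c_s_same : ∀ i j x, i ≠ j → c i (s j i x) = s j i x
  s_c_comm : ∀ i j k x, k ≠ i → k ≠ j → s j i (c k x) = c k (s j i x)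
  c_s_swap : ∀ i j x, c i (s i j x) = c j (s j i x)
  s_comm : ∀ i j k l x, i ≠ j → i ≠ k → i ≠ l → j ≠ k → j ≠ l → k ≠ l →
    s i j (s k l x) = s k l (s i j x)
  s_s : ∀ i j l x, s i l (s l j x) = s i l (s i j x)

section Basic

variable (I : Type u) {A : Type v} [ModalAlgebra A] [MSA I A]

/-- The dimension set `Δ x = {i : c_i x ≠ x}`. -/
def dimSet (x : A) : Set I := {i | MSA.c i x ≠ x}

/-- The universal quantifier `q_i = - c_i -`. -/
def univ {I : Type u} {A : Type v} [ModalAlgebra A] [MSA I A] (i : I) (x : A) : A :=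
  (MSA.c i xᶜ)ᶜ

/-- `Sg X`: the subalgebra generated by `X`. -/
inductive Sg (X : Set A) : A → Prop
  | basic (x : A) : x ∈ X → Sg X x
  | bot : Sg X ⊥
  | top : Sg X ⊤
  | sup (x y : A) : Sg X x → Sg X y → Sg X (x ⊔ y)
  | inf (x y : A) : Sg X x → Sg X y → Sg X (x ⊓ y)
  | compl (x : A) : Sg X x → Sg X xᶜ
  | box (x : A) : Sg X x → Sg X (box x)
  | c (i : I) (x : A) : Sg X x → Sg X (MSA.c i x)
  | s (i j : I) (x : A) : Sg X x → Sg X (MSA.s i j x)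

/-- The subalgebra generated by `X`, as a set. -/
def sg (X : Set A) : Set A := {x | Sg I X x}

/-- `Γ → Δ`: some finite meet of elements of `Γ` lies below some finite join of elements
of `Δ` (the empty meet is `1`, the empty join is `0`). -/
def Entails {A : Type v} [ModalAlgebra A] (Γ Δ : Set A) : Prop :=
  ∃ s t : Finset A, (s : Set A) ⊆ Γ ∧ (t : Set A) ⊆ Δ ∧ s.inf id ≤ t.sup id

/-- `T` is a theory of the subalgebra with universe `S`. -/
def IsTheory {A : Type v} [ModalAlgebra A] (S T : Set A) : Prop :=
  T ⊆ S ∧ ∀ a ∈ S, Entails T {a} → a ∈ T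

/-- `F` is a cotheory of the subalgebra with universe `S`. -/
def IsCotheory {A : Type v} [ModalAlgebra A] (S F : Set A) : Prop :=
  F ⊆ S ∧ ∀ a ∈ S, Entails {a} F → a ∈ F

/-- `(T, F)` is an `(A, X₁, X₂)`-saturated pair. -/
structure Saturated (X₁ X₂ T F : Set A) : Prop where
  theory : IsTheory (sg I X₁) T
  cotheory : IsCotheory (sg I X₂) F
  disjoint : T ∩ F = ∅
  prime_left : ∀ a ∈ sg I X₁, ∀ b ∈ sg I X₁, a ⊔ b ∈ T → a ∈ T ∨ b ∈ T
  witness_left : ∀ a ∈ sg I X₁, ∀ k : I, MSA.c k a ∈ T →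
    ∃ j : I, j ∉ dimSet I a ∧ MSA.s j k a ∈ T
  prime_right : ∀ a ∈ sg I X₂, ∀ b ∈ sg I X₂, a ⊓ b ∈ F → a ∈ F ∨ b ∈ F
  witness_right : ∀ a ∈ sg I X₂, ∀ k : I, univ k a ∈ F →
    ∃ j : I, j ∉ dimSet I a ∧ MSA.s j k a ∈ F

variable (A)

/-- Dimension complemented algebras: the complement of every dimension set is infinite. -/
def IsDc : Prop := ∀ x : A, (dimSet I x)ᶜ.Infinite

/-- The class of dimension complemented algebras that validate the modal axioms in `Λ`. -/
def InClass (Λ : Set ModalAxiom) : Prop := IsDc I A ∧ ∀ φ ∈ Λ, φ.Valid A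

end Basic

/-! Dimension restricted free algebras. -/

/-- The absolutely free algebra of the type of `I`-dimensional modal substitution algebras
with generators `G`. -/
inductive Term (I G : Type u) : Type u
  | var : G → Term I G
  | bot : Term I G
  | top : Term I G
  | sup : Term I G → Term I G → Term I G
  | inf : Term I G → Term I G → Term I G
  | compl : Term I G → Term I G
  | box : Term I G → Term I G
  | c : I → Term I G → Term I G
  | s : I → I → Term I G → Term I G

namespace Term

/-- The homomorphism from the absolutely free algebra to `A` that extends `y`. -/
def eval {I G : Type u} {A : Type v} [ModalAlgebra A] [MSA I A] (y : G → A) : Term I G → A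
  | var g => y g
  | bot => ⊥
  | top => ⊤
  | sup t r => t.eval y ⊔ r.eval y
  | inf t r => t.eval y ⊓ r.eval y
  | compl t => (t.eval y)ᶜ
  | box t => QML.box (t.eval y)
  | c i t => MSA.c i (t.eval y)
  | s i j t => MSA.s i j (t.eval y)

/-- Renaming of the indices of the operations. -/
def map {I J G : Type u} (e : I → J) : Term I G → Term J G
  | var g => var g
  | bot => bot
  | top => top
  | sup t r => sup (t.map e) (r.map e)
  | inf t r => inf (t.map e) (r.map e)
  | compl t => compl (t.map e)
  | box t => box (t.map e)
  | c i t => c (e i) (t.map e)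
  | s i j t => s (e i) (e j) (t.map e)

end Term

section Free

variable {I G : Type u} (Λ : Set ModalAxiom) (ρ : G → Set I)

/-- The congruence `Cr^ρ L` of the class `L` of dimension complemented algebras that validate
`Λ`. It is the intersection of all congruences `θ` of the absolutely free algebra such that the
quotient by `θ` embeds in a member of `L` and `c_k g / θ = g / θ` for all generators `g` and all
`k ∉ ρ g`. These `θ` are the kernels of the homomorphisms to members of `L` that send every
generator `g` to an element `x` with `Δ x ⊆ ρ g`. -/
def Cr (t r : Term I G) : Prop :=
  ∀ (B : Type u) [ModalAlgebra B] [MSA I B], InClass I B Λ →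
    ∀ y : G → B, (∀ g, dimSet I (y g) ⊆ ρ g) → t.eval y = r.eval y

/-- `Cr` as a setoid. -/
def crSetoid : Setoid (Term I G) where
  r := Cr Λ ρ
  iseqv :=
    { refl := fun _ _ _ _ _ _ _ => rfl
      symm := fun h B _ _ hB y hy => (h B hB y hy).symm
      trans := fun h h' B _ _ hB y hy => (h B hB y hy).trans (h' B hB y hy) }

/-- The dimension restricted free algebra `Fr^ρ L` with generators `G`. -/
def Fr : Type u := Quotient (crSetoid Λ ρ)

variable {Λ ρ}

/-- The class of a term in the dimension restricted free algebra. -/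
def Fr.mk (t : Term I G) : Fr Λ ρ := Quotient.mk (crSetoid Λ ρ) t

theorem Fr.ind {p : Fr Λ ρ → Prop} (h : ∀ t, p (Fr.mk t)) : ∀ x, p x :=
  fun x => Quotient.ind h x

theorem Fr.sound {t r : Term I G} (h : Cr Λ ρ t r) : (Fr.mk t : Fr Λ ρ) = Fr.mk r :=
  Quotient.sound h

theorem Fr.exact {t r : Term I G} (h : (Fr.mk t : Fr Λ ρ) = Fr.mk r) : Cr Λ ρ t r :=
  Quotient.exact h

/-- The unary operation on the free algebra induced by an operation on terms. -/
def Fr.lift₁ (f : Term I G → Term I G) (hf : ∀ t t', Cr Λ ρ t t' → Cr Λ ρ (f t) (f t')) :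
    Fr Λ ρ → Fr Λ ρ :=
  Quotient.lift (fun t => Fr.mk (f t)) fun t t' h => Fr.sound (hf t t' h)

/-- The binary operation on the free algebra induced by an operation on terms. -/
def Fr.lift₂ (f : Term I G → Term I G → Term I G)
    (hf : ∀ t t' r r', Cr Λ ρ t t' → Cr Λ ρ r r' → Cr Λ ρ (f t r) (f t' r')) :
    Fr Λ ρ → Fr Λ ρ → Fr Λ ρ :=
  Quotient.lift₂ (fun t r => Fr.mk (f t r)) fun t r t' r' h h' => Fr.sound (hf t t' r r' h h')

instance : Max (Fr Λ ρ) where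
  max := Fr.lift₂ Term.sup fun t t' r r' h h' B _ _ hB y hy => by
    simp only [Term.eval, h B hB y hy, h' B hB y hy]

instance : Min (Fr Λ ρ) where
  min := Fr.lift₂ Term.inf fun t t' r r' h h' B _ _ hB y hy => by
    simp only [Term.eval, h B hB y hy, h' B hB y hy]

instance : Compl (Fr Λ ρ) where
  compl := Fr.lift₁ Term.compl fun t t' h B _ _ hB y hy => by
    simp only [Term.eval, h B hB y hy]

instance : Top (Fr Λ ρ) := ⟨Fr.mk Term.top⟩

instance : Bot (Fr Λ ρ) := ⟨Fr.mk Term.bot⟩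

instance : LE (Fr Λ ρ) := ⟨fun a b => a ⊔ b = b⟩

/-- `□` on the free algebra. -/
def Fr.box : Fr Λ ρ → Fr Λ ρ :=
  Fr.lift₁ Term.box fun t t' h B _ _ hB y hy => by
    simp only [Term.eval, h B hB y hy]

/-- `c_i` on the free algebra. -/
def Fr.c (i : I) : Fr Λ ρ → Fr Λ ρ :=
  Fr.lift₁ (Term.c i) fun t t' h B _ _ hB y hy => by
    simp only [Term.eval, h B hB y hy]

/-- `s_i^j` on the free algebra. -/
def Fr.s (i j : I) : Fr Λ ρ → Fr Λ ρ :=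
  Fr.lift₁ (Term.s i j) fun t t' h B _ _ hB y hy => by
    simp only [Term.eval, h B hB y hy]

theorem Fr.mk_le {t r : Term I G} :
    (Fr.mk t : Fr Λ ρ) ≤ Fr.mk r ↔
      ∀ (B : Type u) [ModalAlgebra B] [MSA I B], InClass I B Λ →
        ∀ y : G → B, (∀ g, dimSet I (y g) ⊆ ρ g) → t.eval y ≤ r.eval y := by
  constructor
  · intro h B _ _ hB y hy
    exact sup_eq_right.mp (Fr.exact (t := Term.sup t r) h B hB y hy)
  · intro h
    exact Fr.sound (t := Term.sup t r) fun B _ _ hB y hy => sup_eq_right.mpr (h B hB y hy)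

instance : ModalAlgebra (Fr Λ ρ) where
  le_refl := Fr.ind fun t => Fr.mk_le.mpr fun _ _ _ _ _ _ => le_rfl
  le_trans := Fr.ind fun t => Fr.ind fun r => Fr.ind fun q => fun h h' =>
    Fr.mk_le.mpr fun B _ _ hB y hy => (Fr.mk_le.mp h B hB y hy).trans (Fr.mk_le.mp h' B hB y hy)
  le_antisymm := Fr.ind fun t => Fr.ind fun r => fun h h' => Fr.sound fun B _ _ hB y hy =>
    (Fr.mk_le.mp h B hB y hy).antisymm (Fr.mk_le.mp h' B hB y hy)
  sup := (· ⊔ ·)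
  inf := (· ⊓ ·)
  le_sup_left := Fr.ind fun t => Fr.ind fun r =>
    Fr.mk_le (r := Term.sup t r).mpr fun _ _ _ _ _ _ => le_sup_left
  le_sup_right := Fr.ind fun t => Fr.ind fun r =>
    Fr.mk_le (r := Term.sup t r).mpr fun _ _ _ _ _ _ => le_sup_right
  sup_le := Fr.ind fun t => Fr.ind fun r => Fr.ind fun q => fun h h' =>
    Fr.mk_le (t := Term.sup t r).mpr fun B _ _ hB y hy =>
      sup_le (Fr.mk_le.mp h B hB y hy) (Fr.mk_le.mp h' B hB y hy)
  inf_le_left := Fr.ind fun t => Fr.ind fun r =>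
    Fr.mk_le (t := Term.inf t r).mpr fun _ _ _ _ _ _ => inf_le_left
  inf_le_right := Fr.ind fun t => Fr.ind fun r =>
    Fr.mk_le (t := Term.inf t r).mpr fun _ _ _ _ _ _ => inf_le_right
  le_inf := Fr.ind fun t => Fr.ind fun r => Fr.ind fun q => fun h h' =>
    Fr.mk_le (r := Term.inf r q).mpr fun B _ _ hB y hy =>
      le_inf (Fr.mk_le.mp h B hB y hy) (Fr.mk_le.mp h' B hB y hy)
  le_sup_inf := Fr.ind fun t => Fr.ind fun r => Fr.ind fun q =>
    Fr.mk_le (t := Term.inf (Term.sup t r) (Term.sup t q))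
      (r := Term.sup t (Term.inf r q)).mpr fun _ _ _ _ _ _ => le_sup_inf
  inf_compl_le_bot := Fr.ind fun t =>
    Fr.mk_le (t := Term.inf t (Term.compl t)) (r := Term.bot).mpr
      fun _ _ _ _ _ _ => BooleanAlgebra.inf_compl_le_bot _
  top_le_sup_compl := Fr.ind fun t =>
    Fr.mk_le (t := Term.top) (r := Term.sup t (Term.compl t)).mpr
      fun _ _ _ _ _ _ => BooleanAlgebra.top_le_sup_compl _
  le_top := Fr.ind fun t => Fr.mk_le (r := Term.top).mpr fun _ _ _ _ _ _ => le_top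
  bot_le := Fr.ind fun t => Fr.mk_le (t := Term.bot).mpr fun _ _ _ _ _ _ => bot_le
  box := Fr.box
  box_top := Fr.sound (t := Term.box Term.top) (r := Term.top)
    fun _ _ _ _ _ _ => ModalAlgebra.box_top
  box_imp := Fr.ind fun t => Fr.ind fun r =>
    Fr.mk_le (t := Term.box (Term.sup (Term.compl t) r))
      (r := Term.sup (Term.compl (Term.box t)) (Term.box r)).mpr
      fun _ _ _ _ _ _ => ModalAlgebra.box_imp _ _

instance : MSA I (Fr Λ ρ) where
  c := Fr.c
  s := Fr.s
  c_bot j := Fr.sound (t := .c j .bot) (r := .bot) fun _ _ _ _ _ _ => MSA.c_bot j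
  le_c i := Fr.ind fun t => Fr.mk_le (r := .c i t).mpr fun _ _ _ _ _ _ => MSA.le_c i _
  c_inf_c i := Fr.ind fun t => Fr.ind fun r =>
    Fr.sound (t := .c i (.inf t (.c i r))) (r := .inf (.c i t) (.c i r))
      fun _ _ _ _ _ _ => MSA.c_inf_c i _ _
  c_sup i := Fr.ind fun t => Fr.ind fun r =>
    Fr.sound (t := .c i (.sup t r)) (r := .sup (.c i t) (.c i r))
      fun _ _ _ _ _ _ => MSA.c_sup i _ _
  c_comm i j := Fr.ind fun t =>
    Fr.sound (t := .c i (.c j t)) (r := .c j (.c i t)) fun _ _ _ _ _ _ => MSA.c_comm i j _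
  s_self i := Fr.ind fun t =>
    Fr.sound (t := .s i i t) (r := t) fun _ _ _ _ _ _ => MSA.s_self i _
  s_sup i j := Fr.ind fun t => Fr.ind fun r =>
    Fr.sound (t := .s i j (.sup t r)) (r := .sup (.s i j t) (.s i j r))
      fun _ _ _ _ _ _ => MSA.s_sup i j _ _
  s_inf i j := Fr.ind fun t => Fr.ind fun r =>
    Fr.sound (t := .s i j (.inf t r)) (r := .inf (.s i j t) (.s i j r))
      fun _ _ _ _ _ _ => MSA.s_inf i j _ _
  s_compl i j := Fr.ind fun t =>
    Fr.sound (t := .s i j (.compl t)) (r := .compl (.s i j t))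
      fun _ _ _ _ _ _ => MSA.s_compl i j _
  s_bot i j := Fr.sound (t := .s i j .bot) (r := .bot) fun _ _ _ _ _ _ => MSA.s_bot i j
  s_top i j := Fr.sound (t := .s i j .top) (r := .top) fun _ _ _ _ _ _ => MSA.s_top i j
  s_box i j := Fr.ind fun t =>
    Fr.sound (t := .s i j (.box t)) (r := .box (.s i j t))
      fun _ _ _ _ _ _ => MSA.s_box i j _
  s_c_same i j := Fr.ind fun t =>
    Fr.sound (t := .s j i (.c i t)) (r := .c i t) fun _ _ _ _ _ _ => MSA.s_c_same i j _
  c_s_same i j := Fr.ind fun t => fun h =>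
    Fr.sound (t := .c i (.s j i t)) (r := .s j i t) fun _ _ _ _ _ _ => MSA.c_s_same i j _ h
  s_c_comm i j k := Fr.ind fun t => fun h h' =>
    Fr.sound (t := .s j i (.c k t)) (r := .c k (.s j i t))
      fun _ _ _ _ _ _ => MSA.s_c_comm i j k _ h h'
  c_s_swap i j := Fr.ind fun t =>
    Fr.sound (t := .c i (.s i j t)) (r := .c j (.s j i t))
      fun _ _ _ _ _ _ => MSA.c_s_swap i j _
  s_comm i j k l := Fr.ind fun t => fun h₁ h₂ h₃ h₄ h₅ h₆ =>
    Fr.sound (t := .s i j (.s k l t)) (r := .s k l (.s i j t))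
      fun _ _ _ _ _ _ => MSA.s_comm i j k l _ h₁ h₂ h₃ h₄ h₅ h₆
  s_s i j l := Fr.ind fun t =>
    Fr.sound (t := .s i l (.s l j t)) (r := .s i l (.s i j t))
      fun _ _ _ _ _ _ => MSA.s_s i j l _

end Free

/-! The canonical Kripke system. -/

/-- A Kripke system: worlds, accessibility relation, and non-empty domains, subsets of a set `X`,
that increase along the accessibility relation. -/
structure KripkeSystem (X : Type u) where
  World : Type v
  Rel : World → World → Prop
  Dom : World → Set X
  dom_nonempty : ∀ w, (Dom w).Nonempty
  dom_mono : ∀ w w', Rel w w' → Dom w ⊆ Dom w'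

section Canonical

open Ordinal

variable {α β : Ordinal.{u}} (Λ : Set ModalAxiom) (ρ : Set.Iio β → Set (Set.Iio α))

/-- `ρ`, seen as a function to subsets of the ordinal `γ`. -/
def extendRestr (γ : Ordinal.{u}) (η : Set.Iio β) : Set (Set.Iio γ) :=
  {j | ∃ i ∈ ρ η, i.1 = j.1}

/-- `Fr_β^ρ L_γ`: the `ρ`-dimension restricted free algebra of dimension `γ` with `β` generators,
over the class of dimension complemented algebras that validate `Λ`. -/
abbrev FrDim (γ : Ordinal.{u}) : Type (u + 1) := Fr (I := Set.Iio γ) Λ (extendRestr ρ γ)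

variable {Λ ρ}

/-- The image of a set `X ⊆ Fr_β^ρ L_γ` in `Fr_β^ρ L_δ`, where `γ ≤ δ`, under the canonical
embedding, which sends generators to generators and keeps `□`, `c_i`, `s_i^j` for `i, j < γ`. -/
def push {γ δ : Ordinal.{u}} (h : γ ≤ δ) (X : Set (FrDim Λ ρ γ)) : Set (FrDim Λ ρ δ) :=
  {y | ∃ t : Term (Set.Iio γ) (Set.Iio β), Fr.mk t ∈ X ∧
    y = Fr.mk (t.map (Set.inclusion (Set.Iio_subset_Iio h)))}

/-- The dimension `α + nω` of the algebra `B_n`. -/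
def dimN (α : Ordinal.{u}) (n : ℕ) : Ordinal.{u} := α + ω * n

theorem le_dimN (α : Ordinal.{u}) (n : ℕ) : α ≤ dimN α n := le_self_add

theorem dimN_mono (α : Ordinal.{u}) {n m : ℕ} (h : n ≤ m) : dimN α n ≤ dimN α m := by
  unfold dimN
  gcongr

theorem dimN_le (α : Ordinal.{u}) (n : ℕ) : dimN α n ≤ α + ω * ω := by
  unfold dimN
  gcongr
  exact (natCast_lt_omega0 n).le

variable (X₁ X₂ : Set (FrDim Λ ρ α))

/-- `Sg^{B_n} X` for `X ⊆ A`, as a subset of `B_n = Fr_β^ρ L_{α + nω}`. -/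
def sgN (n : ℕ) (X : Set (FrDim Λ ρ α)) : Set (FrDim Λ ρ (dimN α n)) :=
  sg (Set.Iio (dimN α n)) (push (le_dimN α n) X)

/-- A pair `(T, F)` of subsets of `B_∞ = Fr_β^ρ L_{α + ω·ω}` is `(X₁, X₂, B_n)`-saturated, where
`B_n` is identified with its image in `B_∞`. -/
def SaturatedAt (n : ℕ) (w : Set (FrDim Λ ρ (α + ω * ω)) × Set (FrDim Λ ρ (α + ω * ω))) : Prop :=
  ∃ T F : Set (FrDim Λ ρ (dimN α n)),
    Saturated (Set.Iio (dimN α n)) (push (le_dimN α n) X₁) (push (le_dimN α n) X₂) T F ∧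
    w.1 = push (dimN_le α n) T ∧ w.2 = push (dimN_le α n) F

/-- The worlds: the pairs that are `(X₁, X₂, B_n)`-saturated for some `n`. -/
def World : Type (u + 1) :=
  {w : Set (FrDim Λ ρ (α + ω * ω)) × Set (FrDim Λ ρ (α + ω * ω)) // ∃ n, SaturatedAt X₁ X₂ n w}

variable {X₁ X₂}

/-- The least `n` such that the world is `(X₁, X₂, B_n)`-saturated. -/
noncomputable def World.level (w : World X₁ X₂) : ℕ := sInf {n | SaturatedAt X₁ X₂ n w.1}

/-- The accessibility relation. -/
def World.Acc (w w' : World X₁ X₂) : Prop :=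
  w.level ≤ w'.level ∧
  (∀ a ∈ push (dimN_le α w.level) (sgN w.level X₁), box a ∈ w.1.1 → a ∈ w'.1.1) ∧
  (∀ b ∈ push (dimN_le α w.level) (sgN w.level X₂), dia b ∈ w.1.2 → b ∈ w'.1.2)

variable (X₁ X₂)

/-- The canonical Kripke system, with domains `D_w = α + nω`, where `n` is the level of `w`. -/
noncomputable def canonicalKripke (hα : ω ≤ α) : KripkeSystem.{u + 1, u + 1} Ordinal.{u} where
  World := World X₁ X₂
  Rel := World.Acc
  Dom w := Set.Iio (dimN α w.level)
  dom_nonempty _ := ⟨0, (omega0_pos.trans_le hα).trans_le (le_dimN α _)⟩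
  dom_mono _ _ h := Set.Iio_subset_Iio (dimN_mono α h.1)

end Canonical

end QML

/-!
Complementation turns the conditions on `F` in a saturated pair `(T, F)` into those on `T`, so that
both halves of a pair are theories.

Seriality: let `(T, F)` be saturated over `B_n`. The sets `{a | □a ∈ T}` and `{b | □b ∈ -F}` are
filters, and by D no element of both subalgebras separates them. This remains true in `B_{n+1}`: a
bijection between the two index sets that fixes the finitely many relevant indices carries a
separating element back to `B_n`. The `ω` new indices are fresh for both filters, so they serve as
Henkin witnesses in a Rasiowa–Sikorski construction, which extends the filters to a saturated pair
over `B_{n+1}`. The level of the new pair could only be smaller than `n` if the pair were saturated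
over two different algebras. But if some generator `x` has `c_i x ≠ x`, then for an index `j` of the
larger algebra only, `s_j^i x` or its complement would belong to the theory, and neither is in the
smaller algebra. So all generators have an empty dimension set, and in that case every pair has
level `0`.

Reflexivity and transitivity: such bijections also carry the validity of T and 4 from `A` to `B_∞`.
-/

namespace QML

section Modal

variable {A : Type v} [ModalAlgebra A]

theorem compl_sup_eq_top_iff {x y : A} : xᶜ ⊔ y = ⊤ ↔ x ≤ y := by
  rw [← himp_eq_top_iff, himp_eq, sup_comm]

theorem box_mono : Monotone (box : A → A) := fun x y h => by
  have hbox := ModalAlgebra.box_imp x y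
  rw [compl_sup_eq_top_iff.mpr h, ModalAlgebra.box_top, top_le_iff] at hbox
  exact compl_sup_eq_top_iff.mp hbox

theorem box_inf_box_le (x y : A) : box x ⊓ box y ≤ box (x ⊓ y) := by
  have himp : x ≤ yᶜ ⊔ (x ⊓ y) := by
    rw [sup_comm, ← himp_eq, le_himp_iff]
  have hbox := (box_mono himp).trans (ModalAlgebra.box_imp y (x ⊓ y))
  rwa [sup_comm, ← himp_eq, le_himp_iff] at hbox

theorem box_le_dia (hD : ModalAxiom.D.Valid A) (x : A) : box x ≤ dia x := by
  have hbot : box (⊥ : A) = ⊥ := by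
    simpa only [dia, compl_top, compl_eq_top] using show dia (⊤ : A) = ⊤ from hD
  rw [dia, le_compl_iff_disjoint_right, disjoint_iff_inf_le, ← hbot, ← inf_compl_self x]
  exact box_inf_box_le x xᶜ

theorem box_le_self (hT : ModalAxiom.T.Valid A) (x : A) : box x ≤ x :=
  compl_sup_eq_top_iff.mp (hT x)

theorem box_le_box_box (h4 : ModalAxiom.four.Valid A) (x : A) : box x ≤ box (box x) :=
  compl_sup_eq_top_iff.mp (h4 x)

end Modal

section Cylindrification

variable {I : Type u} {A : Type v} [ModalAlgebra A] [MSA I A] {i j : I} {x y : A}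

theorem notMem_dimSet : i ∉ dimSet I x ↔ MSA.c i x = x :=
  not_not

theorem c_mono (i : I) : Monotone (MSA.c i : A → A) := fun x y h => by
  rw [← sup_eq_right, ← MSA.c_sup, sup_eq_right.mpr h]

theorem s_eq_self (j : I) (h : MSA.c i x = x) : MSA.s j i x = x := by
  rw [← h, MSA.s_c_same]

theorem c_s_eq_c (k : I) (h : MSA.c j x = x) : MSA.c j (MSA.s j k x) = MSA.c k x := by
  rw [MSA.c_s_swap, s_eq_self k h]

theorem c_eq_of_c_s_eq (hij : i ≠ j) (hj : MSA.c j x = x)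
    (h : MSA.c j (MSA.s j i x) = MSA.s j i x) : MSA.c i x = x := by
  have hx : x = MSA.s j i x := by
    simpa only [MSA.s_s, MSA.s_self, s_eq_self i hj] using s_eq_self i h
  rw [hx, MSA.c_s_same _ _ _ hij]

theorem c_inf_eq (hx : MSA.c i x = x) (hy : MSA.c i y = y) : MSA.c i (x ⊓ y) = x ⊓ y := by
  simpa only [hx, hy] using MSA.c_inf_c i x y

theorem c_compl_eq (h : MSA.c i x = x) : MSA.c i xᶜ = xᶜ := by
  refine le_antisymm (le_compl_iff_disjoint_right.mpr (disjoint_iff.mpr ?_)) (MSA.le_c i _)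
  simpa only [h, compl_inf_eq_bot, MSA.c_bot] using (MSA.c_inf_c i xᶜ x).symm

@[simp]
theorem dimSet_compl (x : A) : dimSet I xᶜ = dimSet I x := by
  ext i
  exact not_congr ⟨fun h => by simpa only [compl_compl] using c_compl_eq h, c_compl_eq⟩

theorem dimSet_bot : dimSet I (⊥ : A) = ∅ :=
  Set.eq_empty_of_forall_notMem fun i => notMem_dimSet.mpr (MSA.c_bot i)

theorem dimSet_top : dimSet I (⊤ : A) = ∅ := by
  rw [← compl_bot, dimSet_compl, dimSet_bot]

theorem dimSet_sup_subset : dimSet I (x ⊔ y) ⊆ dimSet I x ∪ dimSet I y := by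
  intro i hi
  by_contra! h
  rw [Set.mem_union, not_or, notMem_dimSet, notMem_dimSet] at h
  exact hi (by rw [MSA.c_sup, h.1, h.2])

theorem dimSet_inf_subset : dimSet I (x ⊓ y) ⊆ dimSet I x ∪ dimSet I y := by
  intro i hi
  by_contra! h
  rw [Set.mem_union, not_or, notMem_dimSet, notMem_dimSet] at h
  exact hi (c_inf_eq h.1 h.2)

theorem dimSet_c_subset (i : I) : dimSet I (MSA.c i x) ⊆ dimSet I x := by
  intro k hk
  by_contra! h
  rw [notMem_dimSet] at h
  exact hk (by rw [MSA.c_comm, h])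

theorem dimSet_s_subset (i j : I) : dimSet I (MSA.s i j x) ⊆ {i, j} ∪ dimSet I x := by
  intro k hk
  by_contra! h
  simp only [Set.mem_union, Set.mem_insert_iff, Set.mem_singleton_iff, not_or,
    notMem_dimSet] at h
  exact hk (by rw [← MSA.s_c_comm j i k x h.1.2 h.1.1, h.2])

theorem dimSet_box_subset [Nontrivial I] : dimSet I (box x) ⊆ dimSet I x := by
  intro i hi
  by_contra! h
  rw [notMem_dimSet] at h
  obtain ⟨j, hij⟩ := exists_ne i
  have hbox : MSA.s j i (box x) = box x := by rw [MSA.s_box, s_eq_self j h]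
  exact hi (by rw [← hbox, MSA.c_s_same i j _ hij.symm])

theorem compl_mem_sg_iff {X : Set A} : xᶜ ∈ sg I X ↔ x ∈ sg I X :=
  ⟨fun h => compl_compl x ▸ Sg.compl _ h, Sg.compl x⟩

theorem dimSet_eq_empty_of_mem_sg [Nontrivial I] {X : Set A} (hX : ∀ a ∈ X, dimSet I a = ∅)
    (hx : x ∈ sg I X) : dimSet I x = ∅ := by
  induction hx with
  | basic x hx => exact hX x hx
  | bot => exact dimSet_bot
  | top => exact dimSet_top
  | sup x y _ _ ihx ihy =>
    exact Set.subset_eq_empty dimSet_sup_subset (by rw [ihx, ihy, Set.union_empty])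
  | inf x y _ _ ihx ihy =>
    exact Set.subset_eq_empty dimSet_inf_subset (by rw [ihx, ihy, Set.union_empty])
  | compl x _ ih => rw [dimSet_compl, ih]
  | box x _ ih => exact Set.subset_eq_empty dimSet_box_subset ih
  | c i x _ ih => exact Set.subset_eq_empty (dimSet_c_subset i) ih
  | s i j x _ ih => rwa [s_eq_self i (notMem_dimSet.mp (ih ▸ Set.notMem_empty j))]

end Cylindrification

section Theories

variable {I : Type u} {A : Type v} [ModalAlgebra A] {S T F : Set A} {a b : A}

theorem IsTheory.mem_of_le (h : IsTheory S T) (ha : a ∈ T) (hab : a ≤ b) (hb : b ∈ S) : b ∈ T :=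
  h.2 b hb ⟨{a}, {b}, by simpa using ha, by simp, by simpa using hab⟩

theorem IsTheory.inf_mem (h : IsTheory S T) (ha : a ∈ T) (hb : b ∈ T) (hS : a ⊓ b ∈ S) :
    a ⊓ b ∈ T := by
  classical
  exact h.2 _ hS ⟨{a, b}, {a ⊓ b}, by simp [Set.insert_subset_iff, ha, hb], by simp, by simp⟩

theorem IsTheory.top_mem (h : IsTheory S T) (hS : ⊤ ∈ S) : ⊤ ∈ T :=
  h.2 _ hS ⟨∅, {⊤}, by simp, by simp, by simp⟩

theorem isTheory_of_infClosed (hTS : T ⊆ S) (htop : ⊤ ∈ T) (hinf : InfClosed T)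
    (hle : ∀ a ∈ T, ∀ b ∈ S, a ≤ b → b ∈ T) : IsTheory S T := by
  refine ⟨hTS, fun a ha ⟨s, t, hs, ht, hst⟩ => hle (s.inf id) ?_ a ha (hst.trans ?_)⟩
  · exact Finset.inf_induction htop (fun _ hb _ hc => hinf hb hc) fun b hb => hs hb
  · exact Finset.sup_le fun b hb => (ht hb).le

theorem Entails.preimage_compl {Γ Δ : Set A} (h : Entails Γ Δ) :
    Entails (compl ⁻¹' Δ) (compl ⁻¹' Γ) := by
  obtain ⟨s, t, hs, ht, hst⟩ := h
  refine ⟨t.compls, s.compls, fun a ha => ht (Finset.mem_compls.mp ha),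
    fun a ha => hs (Finset.mem_compls.mp ha), ?_⟩
  simpa only [Finset.compls, Finset.inf_map, Finset.sup_map, Finset.compl_inf,
    Finset.compl_sup, Function.comp_def, Function.Embedding.coeFn_mk, id] using compl_le_compl hst

theorem entails_preimage_compl_iff {Γ Δ : Set A} :
    Entails (compl ⁻¹' Γ) (compl ⁻¹' Δ) ↔ Entails Δ Γ :=
  ⟨fun h => by simpa only [Set.preimage_preimage, compl_compl, Set.preimage_id'] using
    h.preimage_compl, Entails.preimage_compl⟩

variable [MSA I A] {X X₁ X₂ : Set A}

theorem isCotheory_iff : IsCotheory (sg I X) F ↔ IsTheory (sg I X) (compl ⁻¹' F) := by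
  refine and_congr ⟨fun h a ha => compl_mem_sg_iff.mp (h ha),
    fun h a ha => compl_mem_sg_iff.mp (h (by rwa [Set.mem_preimage, compl_compl]))⟩ ?_
  rw [compl_surjective.forall]
  have hentails (a : A) : Entails {aᶜ} F ↔ Entails (compl ⁻¹' F) {a} := by
    have hsingleton : compl ⁻¹' {aᶜ} = ({a} : Set A) := by ext; simp
    rw [← entails_preimage_compl_iff, hsingleton]
  simp only [compl_mem_sg_iff, Set.mem_preimage, hentails]

variable (I) in
/-- The conditions on the first component of a saturated pair. Complementation turns the conditions
on the second component into the same ones, see `saturated_iff`. -/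
structure SaturatedTheory (X T : Set A) : Prop where
  theory : IsTheory (sg I X) T
  prime : ∀ a ∈ sg I X, ∀ b ∈ sg I X, a ⊔ b ∈ T → a ∈ T ∨ b ∈ T
  witness : ∀ a ∈ sg I X, ∀ k : I, MSA.c k a ∈ T → ∃ j : I, j ∉ dimSet I a ∧ MSA.s j k a ∈ T

theorem SaturatedTheory.mem_or_compl_mem (hT : SaturatedTheory I X T) (ha : a ∈ sg I X) :
    a ∈ T ∨ aᶜ ∈ T :=
  hT.prime a ha aᶜ ha.compl (by rw [sup_compl_eq_top]; exact hT.theory.top_mem Sg.top)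

theorem saturated_iff : Saturated I X₁ X₂ T F ↔
    SaturatedTheory I X₁ T ∧ SaturatedTheory I X₂ (compl ⁻¹' F) ∧ Disjoint T F := by
  have hprime : (∀ a ∈ sg I X₂, ∀ b ∈ sg I X₂, a ⊓ b ∈ F → a ∈ F ∨ b ∈ F) ↔
      ∀ a ∈ sg I X₂, ∀ b ∈ sg I X₂, a ⊔ b ∈ compl ⁻¹' F →
        a ∈ compl ⁻¹' F ∨ b ∈ compl ⁻¹' F :=
    ⟨fun h a ha b hb hab => h aᶜ ha.compl bᶜ hb.compl (by rwa [← compl_sup]),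
      fun h a ha b hb hab => by simpa using h aᶜ ha.compl bᶜ hb.compl (by simpa using hab)⟩
  have hwitness : (∀ a ∈ sg I X₂, ∀ k : I, univ k a ∈ F →
        ∃ j : I, j ∉ dimSet I a ∧ MSA.s j k a ∈ F) ↔
      ∀ a ∈ sg I X₂, ∀ k : I, MSA.c k a ∈ compl ⁻¹' F →
        ∃ j : I, j ∉ dimSet I a ∧ MSA.s j k a ∈ compl ⁻¹' F := by
    rw [compl_surjective.forall]
    simp only [compl_mem_sg_iff, univ, Set.mem_preimage, compl_compl, dimSet_compl, MSA.s_compl]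
  constructor
  · rintro ⟨hT, hF, hTF, hpT, hwT, hpF, hwF⟩
    exact ⟨⟨hT, hpT, hwT⟩, ⟨isCotheory_iff.mp hF, hprime.mp hpF, hwitness.mp hwF⟩,
      Set.disjoint_iff_inter_eq_empty.mpr hTF⟩
  · rintro ⟨⟨hT, hpT, hwT⟩, ⟨hF, hpF, hwF⟩, hTF⟩
    exact ⟨hT, isCotheory_iff.mpr hF, hTF.inter_eq, hpT, hwT, hprime.mpr hpF, hwitness.mpr hwF⟩

end Theories

section Henkin

variable {I : Type u} {A : Type v} [ModalAlgebra A] [MSA I A] {X Y T U : Set A}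

variable (I) in
/-- No common element of the subalgebras generated by `X` and `Y` separates the filter generated by
`T` and `p` from the filter generated by `U` and `q`; that is, `T, p → -U, -q` has no interpolant.
The sets `T` and `U` are meant to be closed under finite meets. -/
def Inseparable (X Y T U : Set A) (p q : A) : Prop :=
  ∀ t ∈ T, ∀ u ∈ U, ∀ c ∈ sg I X, c ∈ sg I Y → t ⊓ p ≤ c → ¬u ⊓ q ≤ cᶜ

theorem Inseparable.symm {p q : A} (h : Inseparable I X Y T U p q) :
    Inseparable I Y X U T q p :=
  fun u hu t ht c hcY hcX hqc hpc =>
    h t ht u hu cᶜ hcX.compl hcY.compl hpc (by rwa [compl_compl])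

theorem Inseparable.inf_s {p q a : A} {j k : I} (hT : ∀ t ∈ T, j ∉ dimSet I t)
    (hU : ∀ u ∈ U, j ∉ dimSet I u) (hp : j ∉ dimSet I p) (hq : j ∉ dimSet I q)
    (ha : j ∉ dimSet I a) (h : Inseparable I X Y T U (p ⊓ MSA.c k a) q) :
    Inseparable I X Y T U (p ⊓ MSA.s j k a) q := by
  intro t ht u hu c hcX hcY hpc hqc
  have htp : MSA.c j (t ⊓ p) = t ⊓ p :=
    c_inf_eq (notMem_dimSet.mp (hT t ht)) (notMem_dimSet.mp hp)
  have huq : MSA.c j (u ⊓ q)ᶜ = (u ⊓ q)ᶜ :=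
    c_compl_eq (c_inf_eq (notMem_dimSet.mp (hU u hu)) (notMem_dimSet.mp hq))
  refine h t ht u hu (MSA.c j c) (hcX.c _ _) (hcY.c _ _) ?_ ?_
  · calc t ⊓ (p ⊓ MSA.c k a)
      _ = MSA.c j (MSA.s j k a) ⊓ MSA.c j (t ⊓ p) := by
        rw [htp, c_s_eq_c k (notMem_dimSet.mp ha), ← inf_assoc, inf_comm]
      _ = MSA.c j (t ⊓ (p ⊓ MSA.s j k a)) := by
        rw [← MSA.c_inf_c, htp, inf_comm, inf_assoc]
      _ ≤ MSA.c j c := c_mono j hpc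
  · exact le_compl_comm.mp ((c_mono j (le_compl_comm.mp hqc)).trans_eq huq)

variable (I) in
/-- The Henkin requirement for `c_k a` holds at `(p, q)`: either `c_k a` has a witness that is
implied by `p`, or `c_k a` cannot be added to `p` without a separation. -/
def Decided (X Y T U : Set A) (k : I) (a p q : A) : Prop :=
  (∃ j : I, j ∉ dimSet I a ∧ p ≤ MSA.s j k a) ∨ ¬Inseparable I X Y T U (p ⊓ MSA.c k a) q

theorem Inseparable.exists_decided {J : Set I} (hJ : J.Infinite)
    (hfin : ∀ x : A, (dimSet I x ∩ J).Finite) (hT : ∀ t ∈ T, Disjoint (dimSet I t) J)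
    (hU : ∀ u ∈ U, Disjoint (dimSet I u) J) {p q a : A} (hp : p ∈ sg I X) (ha : a ∈ sg I X)
    (h : Inseparable I X Y T U p q) (k : I) :
    ∃ p' ≤ p, p' ∈ sg I X ∧ Inseparable I X Y T U p' q ∧ Decided I X Y T U k a p' q := by
  by_cases hc : Inseparable I X Y T U (p ⊓ MSA.c k a) q
  swap
  · exact ⟨p, le_rfl, hp, h, Or.inr hc⟩
  obtain ⟨j, hjJ, hj⟩ := (hJ.sdiff (((hfin p).union (hfin q)).union (hfin a))).nonempty
  simp only [Set.mem_union, Set.mem_inter_iff, hjJ, and_true, not_or] at hj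
  obtain ⟨⟨hjp, hjq⟩, hja⟩ := hj
  exact ⟨p ⊓ MSA.s j k a, inf_le_left, hp.inf _ _ (ha.s _ _ _),
    hc.inf_s (fun t ht hjt => (hT t ht).notMem_of_mem_left hjt hjJ)
      (fun u hu hju => (hU u hu).notMem_of_mem_left hju hjJ) hjp hjq hja,
    Or.inl ⟨j, hja, inf_le_right⟩⟩

theorem exists_decided_sequences [Countable I] [Countable A] {J : Set I} (hJ : J.Infinite)
    (hfin : ∀ x : A, (dimSet I x ∩ J).Finite) (hT : ∀ t ∈ T, Disjoint (dimSet I t) J)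
    (hU : ∀ u ∈ U, Disjoint (dimSet I u) J) (h : Inseparable I X Y T U ⊤ ⊤) :
    ∃ p q : ℕ → A, Antitone p ∧ Antitone q ∧ (∀ n, Inseparable I X Y T U (p n) (q n)) ∧
      (∀ a ∈ sg I X, ∀ k, ∃ n, Decided I X Y T U k a (p n) (q n)) ∧
      ∀ b ∈ sg I Y, ∀ k, ∃ n, Decided I Y X U T k b (q n) (p n) := by
  let P := {z : A × A // z.1 ∈ sg I X ∧ z.2 ∈ sg I Y ∧ Inseparable I X Y T U z.1 z.2}ᵒᵈ
  let D : (I × sg I X) ⊕ (I × sg I Y) → Order.Cofinal P := Sum.elim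
    (fun r => ⟨{z | Decided I X Y T U r.1 r.2 (OrderDual.ofDual z).1.1 (OrderDual.ofDual z).1.2},
      by
        rintro ⟨⟨p, q⟩, hp, hq, hpq⟩
        obtain ⟨p', hp', hp'X, hpq', hd⟩ := hpq.exists_decided hJ hfin hT hU hp r.2.2 r.1
        exact ⟨OrderDual.toDual ⟨(p', q), hp'X, hq, hpq'⟩, hd, ⟨hp', le_rfl⟩⟩⟩)
    (fun r => ⟨{z | Decided I Y X U T r.1 r.2 (OrderDual.ofDual z).1.2 (OrderDual.ofDual z).1.1},
      by
        rintro ⟨⟨p, q⟩, hp, hq, hpq⟩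
        obtain ⟨q', hq', hq'Y, hpq', hd⟩ :=
          hpq.symm.exists_decided hJ hfin hU hT hq r.2.2 r.1
        exact ⟨OrderDual.toDual ⟨(p, q'), hp, hq'Y, hpq'.symm⟩, hd, ⟨le_rfl, hq'⟩⟩⟩)
  have := Encodable.ofCountable ((I × sg I X) ⊕ (I × sg I Y))
  let z : ℕ → P := Order.sequenceOfCofinals (OrderDual.toDual ⟨(⊤, ⊤), Sg.top, Sg.top, h⟩) D
  have hz : Monotone z := Order.sequenceOfCofinals.monotone _ D
  refine ⟨fun n => (OrderDual.ofDual (z n)).1.1, fun n => (OrderDual.ofDual (z n)).1.2,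
    fun n m hnm => (hz hnm).1, fun n m hnm => (hz hnm).2, fun n => (OrderDual.ofDual (z n)).2.2.2,
    fun a ha k => ⟨_, Order.sequenceOfCofinals.encode_mem _ D (.inl (k, ⟨a, ha⟩))⟩,
    fun b hb k => ⟨_, Order.sequenceOfCofinals.encode_mem _ D (.inr (k, ⟨b, hb⟩))⟩⟩

variable (I) in
/-- The filter of the subalgebra generated by `X` that `T` and the members of the descending
sequence `p` generate. It is the limit of the Henkin construction. -/
def limitFilter (X T : Set A) (p : ℕ → A) : Set A :=
  {a | a ∈ sg I X ∧ ∃ n, ∃ t ∈ T, t ⊓ p n ≤ a}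

theorem isTheory_limitFilter {p : ℕ → A} (hp : Antitone p) (htop : ⊤ ∈ T) (hinf : InfClosed T) :
    IsTheory (sg I X) (limitFilter I X T p) := by
  refine isTheory_of_infClosed (fun a ha => ha.1) ⟨Sg.top, 0, ⊤, htop, le_top⟩ ?_ ?_
  · rintro a ⟨ha, n, t, ht, h⟩ b ⟨hb, m, t', ht', h'⟩
    exact ⟨ha.inf _ _ hb, max n m, t ⊓ t', hinf ht ht',
      le_inf ((inf_le_inf inf_le_left (hp (le_max_left n m))).trans h)
        ((inf_le_inf inf_le_right (hp (le_max_right n m))).trans h')⟩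
  · rintro a ⟨_, n, t, ht, h⟩ b hb hab
    exact ⟨hb, n, t, ht, h.trans hab⟩

theorem compl_notMem_limitFilter {p q : ℕ → A} (hp : Antitone p) (hq : Antitone q)
    (h : ∀ n, Inseparable I X Y T U (p n) (q n)) {c : A} (hc : c ∈ limitFilter I X T p) :
    cᶜ ∉ limitFilter I Y U q := by
  rintro ⟨hcY, m, u, hu, hqc⟩
  obtain ⟨hcX, n, t, ht, hpc⟩ := hc
  exact h (max n m) t ht u hu c hcX (compl_mem_sg_iff.mp hcY)
    ((inf_le_inf_left _ (hp (le_max_left n m))).trans hpc)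
    ((inf_le_inf_left _ (hq (le_max_right n m))).trans hqc)

variable (I) in
/-- A common element of the subalgebras generated by `X` and `Y` that `U` refutes follows from `x`
and `T`. -/
def Refutes (X Y T U : Set A) (x : A) : Prop :=
  ∃ c ∈ sg I X, c ∈ sg I Y ∧ x ⇨ c ∈ T ∧ cᶜ ∈ U

theorem Refutes.notMem (hT : IsTheory (sg I X) T) (hTU : ∀ c ∈ T, cᶜ ∉ U) {x : A}
    (h : Refutes I X Y T U x) : x ∉ T := by
  intro hx
  obtain ⟨c, hcX, -, hxc, hcU⟩ := h
  have hmeet := hT.inf_mem hx hxc ((hT.1 hx).inf _ _ (hT.1 hxc))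
  exact hTU c (hT.mem_of_le hmeet inf_himp_le hcX) hcU

theorem Refutes.sup (hT : IsTheory (sg I X) T) (hU : IsTheory (sg I Y) U) {x y : A}
    (hx : Refutes I X Y T U x) (hy : Refutes I X Y T U y) (hxyX : x ⊔ y ∈ sg I X) :
    Refutes I X Y T U (x ⊔ y) := by
  obtain ⟨c, hcX, hcY, hxc, hcU⟩ := hx
  obtain ⟨d, hdX, hdY, hyd, hdU⟩ := hy
  refine ⟨c ⊔ d, hcX.sup _ _ hdX, hcY.sup _ _ hdY, ?_, ?_⟩
  · refine hT.mem_of_le (hT.inf_mem hxc hyd ((hT.1 hxc).inf _ _ (hT.1 hyd))) ?_ ?_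
    · rw [sup_himp_distrib]
      exact inf_le_inf (himp_le_himp_left le_sup_left) (himp_le_himp_left le_sup_right)
    · rw [himp_eq]
      exact (hcX.sup _ _ hdX).sup _ _ hxyX.compl
  · rw [compl_sup]
    exact hU.inf_mem hcU hdU ((hU.1 hcU).inf _ _ (hU.1 hdU))

theorem Decided.limitFilter {p q : ℕ → A} (htop : ⊤ ∈ T) {k : I} {a : A} (ha : a ∈ sg I X) {n : ℕ}
    (h : Decided I X Y T U k a (p n) (q n)) :
    (∃ j, j ∉ dimSet I a ∧ MSA.s j k a ∈ limitFilter I X T p) ∨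
      Refutes I X Y (limitFilter I X T p) (limitFilter I Y U q) (MSA.c k a) := by
  refine h.imp (fun ⟨j, hj, hp⟩ => ⟨j, hj, ha.s _ _ _, n, ⊤, htop, inf_le_right.trans hp⟩) ?_
  intro h
  simp only [Inseparable, not_forall, not_not] at h
  obtain ⟨t, ht, u, hu, c, hcX, hcY, hpc, hqc⟩ := h
  refine ⟨c, hcX, hcY, ⟨?_, n, t, ht, ?_⟩, hcY.compl, n, u, hu, hqc⟩
  · rw [himp_eq]
    exact hcX.sup _ _ (ha.c _ _).compl
  · rwa [le_himp_iff, inf_assoc]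

theorem saturatedTheory_of_witness_or_refutes (hT : IsTheory (sg I X) T)
    (hU : IsTheory (sg I Y) U) (hTU : ∀ c ∈ T, cᶜ ∉ U) (hdc : ∀ a : A, ∃ k : I, k ∉ dimSet I a)
    (h : ∀ a ∈ sg I X, ∀ k : I, (∃ j, j ∉ dimSet I a ∧ MSA.s j k a ∈ T) ∨
      Refutes I X Y T U (MSA.c k a)) :
    SaturatedTheory I X T := by
  refine ⟨hT, fun a ha b hb hab => ?_, fun a ha k hk =>
    (h a ha k).resolve_right fun hr => hr.notMem hT hTU hk⟩
  -- If `k ∉ Δ a`, then `c_k a = a = s_j^k a`, and the condition for `c_k a` decides `a`.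
  have hmem_or : ∀ a ∈ sg I X, a ∈ T ∨ Refutes I X Y T U a := by
    intro a ha
    obtain ⟨k, hk⟩ := hdc a
    rw [notMem_dimSet] at hk
    have := h a ha k
    simp only [s_eq_self _ hk, hk] at this
    exact this.imp_left fun ⟨_, _, haT⟩ => haT
  by_contra! hnot
  exact (((hmem_or a ha).resolve_left hnot.1).sup hT hU ((hmem_or b hb).resolve_left hnot.2)
    (ha.sup _ _ hb)).notMem hT hTU hab

/-- A filter base in the subalgebra generated by `X` in whose elements the indices of `J` are
fresh. -/
structure IsFreshBase (J : Set I) (X T : Set A) : Prop where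
  subset_sg : T ⊆ sg I X
  top_mem : ⊤ ∈ T
  infClosed : InfClosed T
  disjoint_dimSet : ∀ t ∈ T, Disjoint (dimSet I t) J

theorem subset_limitFilter {p : ℕ → A} (hT : T ⊆ sg I X) : T ⊆ limitFilter I X T p :=
  fun t ht => ⟨hT ht, 0, t, ht, inf_le_left⟩

theorem exists_saturatedTheory_pair [Countable I] [Countable A] {J : Set I} (hJ : J.Infinite)
    (hfin : ∀ x : A, (dimSet I x ∩ J).Finite) (hT : IsFreshBase J X T) (hU : IsFreshBase J Y U)
    (h : Inseparable I X Y T U ⊤ ⊤) :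
    ∃ T' U' : Set A, SaturatedTheory I X T' ∧ SaturatedTheory I Y U' ∧ (∀ c ∈ T', cᶜ ∉ U') ∧
      T ⊆ T' ∧ U ⊆ U' := by
  obtain ⟨p, q, hp, hq, hpq, hdp, hdq⟩ :=
    exists_decided_sequences hJ hfin hT.disjoint_dimSet hU.disjoint_dimSet h
  have hT' := isTheory_limitFilter (I := I) (X := X) hp hT.top_mem hT.infClosed
  have hU' := isTheory_limitFilter (I := I) (X := Y) hq hU.top_mem hU.infClosed
  have hdc (a : A) : ∃ k : I, k ∉ dimSet I a := by
    obtain ⟨k, hkJ, hk⟩ := (hJ.sdiff (hfin a)).nonempty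
    exact ⟨k, fun hka => hk ⟨hka, hkJ⟩⟩
  have hTU : ∀ c ∈ limitFilter I X T p, cᶜ ∉ limitFilter I Y U q :=
    fun c => compl_notMem_limitFilter hp hq hpq
  have hUT : ∀ c ∈ limitFilter I Y U q, cᶜ ∉ limitFilter I X T p :=
    fun c => compl_notMem_limitFilter hq hp fun n => (hpq n).symm
  exact ⟨_, _,
    saturatedTheory_of_witness_or_refutes hT' hU' hTU hdc fun a ha k =>
      (hdp a ha k).elim fun _ hd => hd.limitFilter hT.top_mem ha,
    saturatedTheory_of_witness_or_refutes hU' hT' hUT hdc fun b hb k =>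
      (hdq b hb k).elim fun _ hd => hd.limitFilter hU.top_mem hb,
    hTU, subset_limitFilter hT.subset_sg, subset_limitFilter hU.subset_sg⟩

end Henkin

section Homomorphisms

variable {I J : Type u} {A B : Type v} [ModalAlgebra A] [MSA I A] [ModalAlgebra B] [MSA J B]
  {ι : I → J}

/-- Homomorphisms from an algebra of dimension `I` to the `I`-reduct, along a map `ι : I → J`, of
an algebra of dimension `J`. -/
structure MSAHom (ι : I → J) (A B : Type v) [ModalAlgebra A] [MSA I A] [ModalAlgebra B] [MSA J B]
    extends BoundedLatticeHom A B where
  map_box' : ∀ x, toFun (box x) = box (toFun x)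
  map_c' : ∀ i x, toFun (MSA.c i x) = MSA.c (ι i) (toFun x)
  map_s' : ∀ i j x, toFun (MSA.s i j x) = MSA.s (ι i) (ι j) (toFun x)

namespace MSAHom

instance : FunLike (MSAHom ι A B) A B where
  coe e := e.toFun
  coe_injective e e' h := by
    obtain ⟨e, _, _, _⟩ := e
    obtain ⟨e', _, _, _⟩ := e'
    congr
    exact DFunLike.coe_injective h

instance : BoundedLatticeHomClass (MSAHom ι A B) A B where
  map_sup e := e.map_sup'
  map_inf e := e.map_inf'
  map_top e := e.map_top'
  map_bot e := e.map_bot'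

variable (e : MSAHom ι A B)

theorem map_box (x : A) : e (box x) = box (e x) := e.map_box' x

theorem map_c (i : I) (x : A) : e (MSA.c i x) = MSA.c (ι i) (e x) := e.map_c' i x

theorem map_s (i j : I) (x : A) : e (MSA.s i j x) = MSA.s (ι i) (ι j) (e x) := e.map_s' i j x

variable {e} {X T F : Set A} {x y : A}

theorem le_iff_le (he : Function.Injective e) : e x ≤ e y ↔ x ≤ y := by
  rw [← sup_eq_right, ← sup_eq_right (a := x), ← he.eq_iff, map_sup]

theorem mem_dimSet_iff (he : Function.Injective e) {i : I} :
    ι i ∈ dimSet J (e x) ↔ i ∈ dimSet I x := by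
  simp only [dimSet, Set.mem_ofPred_eq, ne_eq, ← map_c, he.eq_iff]

theorem image_preimage_compl (F : Set A) : e '' (compl ⁻¹' F) = compl ⁻¹' (e '' F) := by
  ext y
  constructor
  · rintro ⟨x, hx, rfl⟩
    exact ⟨xᶜ, hx, map_compl' e x⟩
  · rintro ⟨x, hx, hxy⟩
    exact ⟨xᶜ, by rwa [Set.mem_preimage, compl_compl], by rw [map_compl', hxy, compl_compl]⟩

theorem map_mem_sg (hx : x ∈ sg I X) : e x ∈ sg J (e '' X) := by
  induction hx with
  | basic x hx => exact Sg.basic _ ⟨x, hx, rfl⟩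
  | bot => exact map_bot e ▸ Sg.bot
  | top => exact map_top e ▸ Sg.top
  | sup x y _ _ hx hy =>
    rw [map_sup]
    exact hx.sup _ _ hy
  | inf x y _ _ hx hy =>
    rw [map_inf]
    exact hx.inf _ _ hy
  | compl x _ hx => exact map_compl' e x ▸ Sg.compl _ hx
  | box x _ hx => exact e.map_box x ▸ Sg.box _ hx
  | c i x _ hx => exact e.map_c i x ▸ Sg.c _ _ hx
  | s i j x _ hx => exact e.map_s i j x ▸ Sg.s _ _ _ hx

theorem sg_image_subset_of_dimSet_eq_empty [Nontrivial J]
    (hX : ∀ x ∈ X, dimSet J (e x) = ∅) : sg J (e '' X) ⊆ e '' sg I X := by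
  intro y hy
  have hc {z : B} (hz : z ∈ sg J (e '' X)) (j : J) : MSA.c j z = z :=
    notMem_dimSet.mp (by
      rw [dimSet_eq_empty_of_mem_sg (Set.forall_mem_image.mpr hX) hz]
      exact Set.notMem_empty j)
  induction hy with
  | basic y hy => exact Set.image_mono Sg.basic hy
  | bot => exact ⟨⊥, Sg.bot, map_bot e⟩
  | top => exact ⟨⊤, Sg.top, map_top e⟩
  | sup _ _ _ _ hy hz =>
    obtain ⟨y, hy, rfl⟩ := hy
    obtain ⟨z, hz, rfl⟩ := hz
    exact ⟨y ⊔ z, hy.sup _ _ hz, map_sup e y z⟩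
  | inf _ _ _ _ hy hz =>
    obtain ⟨y, hy, rfl⟩ := hy
    obtain ⟨z, hz, rfl⟩ := hz
    exact ⟨y ⊓ z, hy.inf _ _ hz, map_inf e y z⟩
  | compl _ _ hy =>
    obtain ⟨y, hy, rfl⟩ := hy
    exact ⟨yᶜ, hy.compl, map_compl' e y⟩
  | box _ _ hy =>
    obtain ⟨y, hy, rfl⟩ := hy
    exact ⟨box y, hy.box, e.map_box y⟩
  | c j z hz hy => rwa [hc hz j]
  | s i j z hz hy => rwa [s_eq_self i (hc hz j)]

theorem isTheory_image {S : Set A} (he : Function.Injective e) (h : IsTheory S T)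
    (htop : ⊤ ∈ S) (hinf : InfClosed S) : IsTheory (e '' S) (e '' T) := by
  refine isTheory_of_infClosed (Set.image_mono h.1) ⟨⊤, h.top_mem htop, map_top e⟩ ?_ ?_
  · rintro _ ⟨a, ha, rfl⟩ _ ⟨b, hb, rfl⟩
    exact ⟨a ⊓ b, h.inf_mem ha hb (hinf (h.1 ha) (h.1 hb)), map_inf e a b⟩
  · rintro _ ⟨a, ha, rfl⟩ _ ⟨b, hb, rfl⟩ hab
    exact ⟨b, h.mem_of_le ha ((le_iff_le he).mp hab) hb, rfl⟩

theorem saturatedTheory_preimage_of_dimSet_eq_empty [Nontrivial I] {T : Set B}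
    (he : Function.Injective e) (hX : ∀ x ∈ X, dimSet I x = ∅) (hTX : T ⊆ e '' sg I X)
    (hT : SaturatedTheory J (e '' X) T) : SaturatedTheory I X (e ⁻¹' T) := by
  have hsub : e ⁻¹' T ⊆ sg I X := by
    rw [← he.preimage_image (sg I X)]
    exact Set.preimage_mono hTX
  refine ⟨isTheory_of_infClosed hsub ?_ ?_ ?_, ?_, ?_⟩
  · rw [Set.mem_preimage, map_top]
    exact hT.theory.top_mem Sg.top
  · intro a ha b hb
    rw [Set.mem_preimage, map_inf]
    exact hT.theory.inf_mem ha hb ((hT.theory.1 ha).inf _ _ (hT.theory.1 hb))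
  · intro a ha b hb hab
    exact hT.theory.mem_of_le ha ((le_iff_le he).mpr hab) (map_mem_sg hb)
  · intro a ha b hb hab
    rw [Set.mem_preimage, map_sup] at hab
    exact hT.prime _ (map_mem_sg ha) _ (map_mem_sg hb) hab
  · intro a ha k hk
    have hka : k ∉ dimSet I a := dimSet_eq_empty_of_mem_sg hX ha ▸ Set.notMem_empty k
    exact ⟨k, hka, by rwa [MSA.s_self, ← notMem_dimSet.mp hka]⟩

end MSAHom

end Homomorphisms

namespace Term

variable {I J K G : Type u}

/-- The generators that occur in a term. -/
def gens : Term I G → Set G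
  | var g => {g}
  | bot => ∅
  | top => ∅
  | sup t r => t.gens ∪ r.gens
  | inf t r => t.gens ∪ r.gens
  | compl t => t.gens
  | box t => t.gens
  | c _ t => t.gens
  | s _ _ t => t.gens

/-- The indices of the operations that occur in a term. -/
def idx : Term I G → Set I
  | var _ => ∅
  | bot => ∅
  | top => ∅
  | sup t r => t.idx ∪ r.idx
  | inf t r => t.idx ∪ r.idx
  | compl t => t.idx
  | box t => t.idx
  | c i t => {i} ∪ t.idx
  | s i j t => {i, j} ∪ t.idx

theorem finite_gens (t : Term I G) : t.gens.Finite := by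
  induction t <;> simp_all [gens]

theorem finite_idx (t : Term I G) : t.idx.Finite := by
  induction t <;> simp_all [idx]

theorem gens_map (f : I → J) (t : Term I G) : (t.map f).gens = t.gens := by
  induction t <;> simp_all [gens, map]

theorem idx_map (f : I → J) (t : Term I G) : (t.map f).idx = f '' t.idx := by
  induction t <;> simp_all [idx, map, Set.image_union, Set.image_insert_eq]

theorem map_map (f : I → J) (g : J → K) (t : Term I G) : (t.map f).map g = t.map (g ∘ f) := by
  induction t <;> simp_all [map]

theorem map_congr {f g : I → J} {t : Term I G} (h : Set.EqOn f g t.idx) :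
    t.map f = t.map g := by
  induction t <;> simp_all [map, idx, Set.EqOn]

theorem map_id (t : Term I G) : t.map id = t := by
  induction t <;> simp_all [map]

theorem map_map_eq_self {f : I → J} {g : J → I} {t : Term I G} (h : Set.LeftInvOn g f t.idx) :
    (t.map f).map g = t := by
  rw [map_map, map_congr (f := g ∘ f) (g := id) h, map_id]

theorem eval_congr {B : Type v} [ModalAlgebra B] [MSA I B] {y z : G → B} {t : Term I G}
    (h : Set.EqOn y z t.gens) : t.eval y = t.eval z := by
  induction t <;> simp_all [eval, gens, Set.EqOn]

theorem dimSet_eval_subset {B : Type v} [ModalAlgebra B] [MSA I B] [Nontrivial I] (y : G → B)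
    (t : Term I G) : dimSet I (t.eval y) ⊆ t.idx ∪ ⋃ g ∈ t.gens, dimSet I (y g) := by
  induction t with
  | var g => simp [eval, idx, gens]
  | bot => simp [eval, dimSet_bot]
  | top => simp [eval, dimSet_top]
  | sup t r ht hr =>
    rw [idx, gens, Set.biUnion_union, Set.union_union_union_comm]
    exact dimSet_sup_subset.trans (Set.union_subset_union ht hr)
  | inf t r ht hr =>
    rw [idx, gens, Set.biUnion_union, Set.union_union_union_comm]
    exact dimSet_inf_subset.trans (Set.union_subset_union ht hr)
  | compl t ht => rwa [eval, dimSet_compl]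
  | box t ht => exact dimSet_box_subset.trans ht
  | c i t ht =>
    rw [idx, Set.union_assoc]
    exact (dimSet_c_subset i).trans (ht.trans Set.subset_union_right)
  | s i j t ht =>
    rw [idx, Set.union_assoc]
    exact (dimSet_s_subset i j).trans (Set.union_subset_union_right _ ht)

/-- A numbering of the terms, with the operation symbol as the first component of the code. It
serves to show that there are only countably many terms. -/
def code [Encodable I] [Encodable G] : Term I G → ℕ
  | var g => Nat.pair 0 (Encodable.encode g)
  | bot => Nat.pair 1 0
  | top => Nat.pair 2 0
  | sup t r => Nat.pair 3 (Nat.pair t.code r.code)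
  | inf t r => Nat.pair 4 (Nat.pair t.code r.code)
  | compl t => Nat.pair 5 t.code
  | box t => Nat.pair 6 t.code
  | c i t => Nat.pair 7 (Nat.pair (Encodable.encode i) t.code)
  | s i j t => Nat.pair 8 (Nat.pair (Encodable.encode (i, j)) t.code)

theorem code_injective [Encodable I] [Encodable G] :
    Function.Injective (code : Term I G → ℕ) := by
  intro t
  induction t <;> intro r h <;> cases r <;>
    simp only [code, Nat.pair_eq_pair, Encodable.encode_inj, Prod.mk.injEq] at h <;> grind

instance [Countable I] [Countable G] : Countable (Term I G) :=
  have := Encodable.ofCountable I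
  have := Encodable.ofCountable G
  code_injective.countable

end Term

section Reduct

variable {I J G : Type u}

/-- The reduct of an algebra of dimension `J` along an injection of index sets. -/
abbrev MSA.reduct {f : I → J} (hf : Function.Injective f) (B : Type v) [ModalAlgebra B]
    [MSA J B] : MSA I B where
  c i := MSA.c (f i)
  s i j := MSA.s (f i) (f j)
  c_bot _ := MSA.c_bot _
  le_c _ := MSA.le_c _
  c_inf_c _ := MSA.c_inf_c _
  c_sup _ := MSA.c_sup _
  c_comm _ _ := MSA.c_comm _ _
  s_self _ := MSA.s_self _
  s_sup _ _ := MSA.s_sup _ _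
  s_inf _ _ := MSA.s_inf _ _
  s_compl _ _ := MSA.s_compl _ _
  s_bot _ _ := MSA.s_bot _ _
  s_top _ _ := MSA.s_top _ _
  s_box _ _ := MSA.s_box _ _
  s_c_same _ _ := MSA.s_c_same _ _
  c_s_same _ _ _ h := MSA.c_s_same _ _ _ (hf.ne h)
  s_c_comm _ _ _ _ h h' := MSA.s_c_comm _ _ _ _ (hf.ne h) (hf.ne h')
  c_s_swap _ _ := MSA.c_s_swap _ _
  s_comm _ _ _ _ _ h₁ h₂ h₃ h₄ h₅ h₆ := MSA.s_comm _ _ _ _ _ (hf.ne h₁) (hf.ne h₂) (hf.ne h₃)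
    (hf.ne h₄) (hf.ne h₅) (hf.ne h₆)
  s_s _ _ _ := MSA.s_s _ _ _

section

variable {B : Type v} [ModalAlgebra B] [MSA J B]

theorem Term.eval_map {f : I → J} (hf : Function.Injective f) (y : G → B) (t : Term I G) :
    (t.map f).eval y = @Term.eval I G B _ (MSA.reduct hf B) y t := by
  induction t <;> simp_all only [Term.map, Term.eval] <;> rfl

theorem dimSet_reduct {f : I → J} (hf : Function.Injective f) (x : B) :
    @dimSet I B _ (MSA.reduct hf B) x = f ⁻¹' dimSet J x :=
  rfl

theorem inClass_reduct (e : I ≃ J) {Λ : Set ModalAxiom} (h : InClass J B Λ) :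
    @InClass I B _ (MSA.reduct e.injective B) Λ := by
  refine ⟨fun x => ?_, h.2⟩
  rw [dimSet_reduct, ← Set.preimage_compl]
  exact (h.1 x).preimage (e.surjective.range_eq ▸ Set.subset_univ _)

end

variable {Λ : Set ModalAxiom} {ρ : G → Set I} {ρ' : G → Set J} {t r : Term I G}

theorem Cr.map_equiv (e : I ≃ J) (h : ∀ g ∈ t.gens ∪ r.gens, e ⁻¹' ρ' g ⊆ ρ g)
    (H : Cr Λ ρ t r) : Cr Λ ρ' (t.map e) (r.map e) := by
  classical
  intro B _ _ hB y hy
  rw [Term.eval_map e.injective, Term.eval_map e.injective]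
  let _ := MSA.reduct e.injective B
  let z : G → B := fun g => if g ∈ t.gens ∪ r.gens then y g else ⊥
  have hz (g : G) : dimSet I (z g) ⊆ ρ g := by
    by_cases hg : g ∈ t.gens ∪ r.gens
    · simp only [z, if_pos hg]
      exact (Set.preimage_mono (hy g)).trans (h g hg)
    · simp only [z, if_neg hg, dimSet_bot, Set.empty_subset]
  have hzy : Set.EqOn z y (t.gens ∪ r.gens) := fun g hg => if_pos hg
  rw [← Term.eval_congr (hzy.mono Set.subset_union_left),
    ← Term.eval_congr (hzy.mono Set.subset_union_right)]
  exact H B (inClass_reduct e hB) z hz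

theorem Cr.map_equiv_iff (e : I ≃ J) (h : ∀ g ∈ t.gens ∪ r.gens, e ⁻¹' ρ' g = ρ g) :
    Cr Λ ρ' (t.map e) (r.map e) ↔ Cr Λ ρ t r := by
  refine ⟨fun H => ?_, Cr.map_equiv e fun g hg => (h g hg).le⟩
  have hcancel (t : Term I G) : (t.map e).map e.symm = t :=
    Term.map_map_eq_self fun i _ => e.symm_apply_apply i
  rw [← hcancel t, ← hcancel r]
  refine Cr.map_equiv e.symm (fun g hg => ?_) H
  rw [← h g (by simpa only [Term.gens_map] using hg), ← Set.preimage_comp]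
  exact (congrArg (· ⁻¹' ρ' g) e.self_comp_symm).le

end Reduct

theorem exists_equiv_eqOn {I J : Type u} {ι : I → J} (hι : Function.Injective ι)
    (hc : (Set.range ι)ᶜ.Countable) {K : Set I} (hK : Kᶜ.Infinite) :
    ∃ e : I ≃ J, Set.EqOn e ι K := by
  let f : K ↪ J := ⟨K.domRestrict ι, hι.injOn.injective⟩
  have hf : (Set.range f)ᶜ = ι '' Kᶜ ∪ (Set.range ι)ᶜ := by
    have hrange : Set.range f = ι '' K := Set.range_domRestrict ι K
    rw [hrange, Set.image_compl_eq_range_sdiff_image hι]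
    ext j
    have : j ∈ ι '' K → j ∈ Set.range ι := fun h => Set.image_subset_range _ _ h
    simp only [Set.mem_compl_iff, Set.mem_union, Set.mem_sdiff]
    tauto
  have hcard : Cardinal.mk (Kᶜ : Set I) = Cardinal.mk ((Set.range f)ᶜ : Set J) := by
    have hKinf := Cardinal.infinite_iff.mp hK.to_subtype
    rw [hf, Cardinal.mk_union_of_disjoint, Cardinal.mk_image_eq hι, Cardinal.add_eq_left hKinf]
    · exact (Cardinal.le_aleph0_iff_set_countable.mpr hc).trans hKinf
    · exact disjoint_compl_right.mono_left (Set.image_subset_range _ _)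
  obtain ⟨e, he⟩ := Cardinal.extend_function f (Cardinal.eq.mp hcard)
  exact ⟨e, fun i hi => he ⟨i, hi⟩⟩

section FreeAlgebras

variable {I J G : Type u} {Λ : Set ModalAxiom} {ρ : G → Set I} {ρ' : G → Set J} {ι : I → J}

theorem Fr.mk_eq_mk {t r : Term I G} : (Fr.mk t : Fr Λ ρ) = Fr.mk r ↔ Cr Λ ρ t r :=
  ⟨Fr.exact, Fr.sound⟩

theorem Fr.exists_mk_eq : ∀ x : Fr Λ ρ, ∃ t, Fr.mk t = x :=
  Fr.ind fun t => ⟨t, rfl⟩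

theorem Fr.valid {φ : ModalAxiom} (hφ : φ ∈ Λ) : φ.Valid (Fr Λ ρ) := by
  cases φ with
  | D =>
    exact Fr.sound (t := .compl (.box (.compl .top))) (r := .top) fun _ _ _ hB _ _ => hB.2 _ hφ
  | T =>
    exact Fr.ind fun t => Fr.sound (t := .sup (.compl (.box t)) t) (r := .top)
      fun _ _ _ hB _ _ => hB.2 _ hφ _
  | four =>
    exact Fr.ind fun t => Fr.sound (t := .sup (.compl (.box t)) (.box (.box t))) (r := .top)
      fun _ _ _ hB _ _ => hB.2 _ hφ _

theorem Fr.dimSet_mk_subset [Nontrivial I] (t : Term I G) :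
    dimSet I (Fr.mk t : Fr Λ ρ) ⊆ t.idx ∪ ⋃ g ∈ t.gens, ρ g := by
  intro i
  contrapose!
  intro hi
  refine notMem_dimSet.mpr (Fr.sound (t := .c i t) fun B _ _ _ y hy => notMem_dimSet.mp fun h =>
    hi (Set.union_subset_union_right _ ?_ (Term.dimSet_eval_subset y t h)))
  exact Set.iUnion₂_mono fun g _ => hy g

instance [Countable I] [Countable G] : Countable (Fr Λ ρ) :=
  inferInstanceAs (Countable (Quotient _))

/-- The index set `J` extends `I`, through the injection `ι`, by countably many indices, which
occur in none of the dimension restrictions `ρ'`; all but infinitely many indices in `I` are left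
out by any finitely many of the restrictions. -/
structure IsDimExtension (ι : I → J) (ρ : G → Set I) (ρ' : G → Set J) : Prop where
  inj : Function.Injective ι
  countable : (Set.range ι)ᶜ.Countable
  restr : ∀ g, ρ' g = ι '' ρ g
  infinite : ∀ Γ : Set G, Γ.Finite → (⋃ g ∈ Γ, ρ g)ᶜ.Infinite

namespace IsDimExtension

theorem exists_leftInvOn_mk_eq_iff (h : IsDimExtension ι ρ ρ') {Γ : Set G} (hΓ : Γ.Finite)
    {S : Set I} (hS : S.Finite) :
    ∃ f : J → I, Set.LeftInvOn f ι S ∧ ∀ t r : Term J G, t.gens ⊆ Γ → r.gens ⊆ Γ →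
      ((Fr.mk (t.map f) : Fr Λ ρ) = Fr.mk (r.map f) ↔ (Fr.mk t : Fr Λ ρ') = Fr.mk r) := by
  have hK : (S ∪ ⋃ g ∈ Γ, ρ g)ᶜ.Infinite := by
    rw [Set.compl_union, Set.inter_comm, ← Set.sdiff_eq]
    exact (h.infinite Γ hΓ).sdiff hS
  obtain ⟨e, he⟩ := exists_equiv_eqOn h.inj h.countable hK
  refine ⟨e.symm, fun i hi => ?_, fun t r ht hr => ?_⟩
  · rw [← he (Or.inl hi), e.symm_apply_apply]
  · rw [Fr.mk_eq_mk, Fr.mk_eq_mk]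
    refine Cr.map_equiv_iff e.symm fun g hg => ?_
    rw [← e.image_eq_preimage_symm, h.restr]
    exact Set.image_congr fun i hi =>
      he (Or.inr (Set.mem_biUnion (Set.union_subset ht hr hg) hi))

theorem mk_map_eq_iff (h : IsDimExtension ι ρ ρ') {t r : Term I G} :
    (Fr.mk (t.map ι) : Fr Λ ρ') = Fr.mk (r.map ι) ↔ (Fr.mk t : Fr Λ ρ) = Fr.mk r := by
  obtain ⟨f, hf, hmk⟩ := h.exists_leftInvOn_mk_eq_iff (Λ := Λ)
    (t.finite_gens.union r.finite_gens) (t.finite_idx.union r.finite_idx)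
  rw [← hmk, Term.map_map_eq_self (hf.mono Set.subset_union_left),
    Term.map_map_eq_self (hf.mono Set.subset_union_right)]
  · exact t.gens_map ι ▸ Set.subset_union_left
  · exact r.gens_map ι ▸ Set.subset_union_right

theorem mk_eq_mk_of_forall_map (h : IsDimExtension ι ρ ρ') {t r : Term J G}
    (H : ∀ f : J → I, (Fr.mk (t.map f) : Fr Λ ρ) = Fr.mk (r.map f)) :
    (Fr.mk t : Fr Λ ρ') = Fr.mk r := by
  obtain ⟨f, -, hf⟩ := h.exists_leftInvOn_mk_eq_iff (t.finite_gens.union r.finite_gens)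
    Set.finite_empty
  exact (hf t r Set.subset_union_left Set.subset_union_right).mp (H f)

theorem valid (h : IsDimExtension ι ρ ρ') {φ : ModalAxiom} (hφ : φ.Valid (Fr Λ ρ)) :
    φ.Valid (Fr Λ ρ') := by
  cases φ with
  | D =>
    exact h.mk_eq_mk_of_forall_map (t := .compl (.box (.compl .top))) (r := .top) fun _ => hφ
  | T =>
    exact Fr.ind fun t => h.mk_eq_mk_of_forall_map (t := .sup (.compl (.box t)) t) (r := .top)
      fun f => hφ (Fr.mk (t.map f))
  | four =>
    exact Fr.ind fun t => h.mk_eq_mk_of_forall_map (t := .sup (.compl (.box t)) (.box (.box t)))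
      (r := .top) fun f => hφ (Fr.mk (t.map f))

/-- The canonical embedding of free algebras, which renames the indices of terms. -/
def embed (h : IsDimExtension ι ρ ρ') : MSAHom ι (Fr Λ ρ) (Fr Λ ρ') where
  toFun := Quotient.map (Term.map ι) fun _ _ H => Fr.exact (h.mk_map_eq_iff.mpr (Fr.sound H))
  map_sup' := Fr.ind fun _ => Fr.ind fun _ => rfl
  map_inf' := Fr.ind fun _ => Fr.ind fun _ => rfl
  map_top' := rfl
  map_bot' := rfl
  map_box' := Fr.ind fun _ => rfl
  map_c' _ := Fr.ind fun _ => rfl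
  map_s' _ _ := Fr.ind fun _ => rfl

theorem embed_mk (h : IsDimExtension ι ρ ρ') (t : Term I G) :
    h.embed (Fr.mk t : Fr Λ ρ) = Fr.mk (t.map ι) :=
  rfl

theorem embed_injective (h : IsDimExtension ι ρ ρ') :
    Function.Injective (h.embed (Λ := Λ)) := fun x y H => by
  obtain ⟨t, rfl⟩ := Fr.exists_mk_eq x
  obtain ⟨r, rfl⟩ := Fr.exists_mk_eq y
  exact h.mk_map_eq_iff.mp H

theorem infinite_domain (h : IsDimExtension ι ρ ρ') : Infinite I :=
  Set.infinite_univ_iff.mp ((h.infinite ∅ Set.finite_empty).mono (Set.subset_univ _))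

theorem infinite_codomain (h : IsDimExtension ι ρ ρ') : Infinite J :=
  have := h.infinite_domain
  Infinite.of_injective ι h.inj

theorem restr_subset_range (h : IsDimExtension ι ρ ρ') (g : G) : ρ' g ⊆ Set.range ι :=
  h.restr g ▸ Set.image_subset_range _ _

theorem dimSet_embed_subset (h : IsDimExtension ι ρ ρ') (x : Fr Λ ρ) :
    dimSet J (h.embed x) ⊆ Set.range ι := by
  have := h.infinite_codomain
  obtain ⟨t, rfl⟩ := Fr.exists_mk_eq x
  refine (Fr.dimSet_mk_subset (t.map ι)).trans (Set.union_subset ?_ ?_)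
  · exact t.idx_map ι ▸ Set.image_subset_range _ _
  · exact Set.iUnion₂_subset fun g _ => h.restr_subset_range g

theorem dimSet_embed (h : IsDimExtension ι ρ ρ') (x : Fr Λ ρ) :
    dimSet J (h.embed x) = ι '' dimSet I x := by
  ext j
  constructor
  · intro hj
    obtain ⟨i, rfl⟩ := h.dimSet_embed_subset x hj
    exact ⟨i, (MSAHom.mem_dimSet_iff h.embed_injective).mp hj, rfl⟩
  · rintro ⟨i, hi, rfl⟩
    exact (MSAHom.mem_dimSet_iff h.embed_injective).mpr hi

theorem finite_dimSet_inter (h : IsDimExtension ι ρ ρ') (x : Fr Λ ρ') :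
    (dimSet J x ∩ (Set.range ι)ᶜ).Finite := by
  have := h.infinite_codomain
  obtain ⟨t, rfl⟩ := Fr.exists_mk_eq x
  refine t.finite_idx.subset fun j hj => (Fr.dimSet_mk_subset t hj.1).resolve_right fun hj' => ?_
  obtain ⟨g, -, hg⟩ := Set.mem_iUnion₂.mp hj'
  exact hj.2 (h.restr_subset_range g hg)

theorem exists_term_of_mem_sg (h : IsDimExtension ι ρ ρ') {X : Set (Fr Λ ρ)} {x : Fr Λ ρ'}
    (hx : x ∈ sg J (h.embed '' X)) :
    ∃ (t : Term J G) (S : Set I), S.Finite ∧ Fr.mk t = x ∧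
      ∀ f : J → I, Set.LeftInvOn f ι S → Fr.mk (t.map f) ∈ sg I X := by
  induction hx with
  | basic x hx =>
    obtain ⟨x, ht, rfl⟩ := hx
    obtain ⟨t, rfl⟩ := Fr.exists_mk_eq x
    refine ⟨t.map ι, t.idx, t.finite_idx, rfl, fun f hf => ?_⟩
    rw [Term.map_map_eq_self hf]
    exact Sg.basic _ ht
  | bot => exact ⟨.bot, ∅, Set.finite_empty, rfl, fun _ _ => Sg.bot⟩
  | top => exact ⟨.top, ∅, Set.finite_empty, rfl, fun _ _ => Sg.top⟩
  | sup x y _ _ hx hy =>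
    obtain ⟨t, S, hS, rfl, ht⟩ := hx
    obtain ⟨r, S', hS', rfl, hr⟩ := hy
    exact ⟨.sup t r, S ∪ S', hS.union hS', rfl, fun f hf => Sg.sup _ _
      (ht f (hf.mono Set.subset_union_left)) (hr f (hf.mono Set.subset_union_right))⟩
  | inf x y _ _ hx hy =>
    obtain ⟨t, S, hS, rfl, ht⟩ := hx
    obtain ⟨r, S', hS', rfl, hr⟩ := hy
    exact ⟨.inf t r, S ∪ S', hS.union hS', rfl, fun f hf => Sg.inf _ _
      (ht f (hf.mono Set.subset_union_left)) (hr f (hf.mono Set.subset_union_right))⟩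
  | compl x _ hx =>
    obtain ⟨t, S, hS, rfl, ht⟩ := hx
    exact ⟨.compl t, S, hS, rfl, fun f hf => Sg.compl _ (ht f hf)⟩
  | box x _ hx =>
    obtain ⟨t, S, hS, rfl, ht⟩ := hx
    exact ⟨.box t, S, hS, rfl, fun f hf => Sg.box _ (ht f hf)⟩
  | c i x _ hx =>
    obtain ⟨t, S, hS, rfl, ht⟩ := hx
    exact ⟨.c i t, S, hS, rfl, fun f hf => Sg.c _ _ (ht f hf)⟩
  | s i j x _ hx =>
    obtain ⟨t, S, hS, rfl, ht⟩ := hx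
    exact ⟨.s i j t, S, hS, rfl, fun f hf => Sg.s _ _ _ (ht f hf)⟩

theorem exists_separator (h : IsDimExtension ι ρ ρ') {X₁ X₂ : Set (Fr Λ ρ)} {x y : Fr Λ ρ}
    {z : Fr Λ ρ'} (hz₁ : z ∈ sg J (h.embed '' X₁)) (hz₂ : z ∈ sg J (h.embed '' X₂))
    (hx : h.embed x ≤ z) (hy : h.embed y ≤ zᶜ) :
    ∃ w, w ∈ sg I X₁ ∧ w ∈ sg I X₂ ∧ x ≤ w ∧ y ≤ wᶜ := by
  obtain ⟨t, S, hS, rfl, ht⟩ := h.exists_term_of_mem_sg hz₁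
  obtain ⟨t', S', hS', htt', ht'⟩ := h.exists_term_of_mem_sg hz₂
  obtain ⟨p, rfl⟩ := Fr.exists_mk_eq x
  obtain ⟨q, rfl⟩ := Fr.exists_mk_eq y
  obtain ⟨f, hf, hmk⟩ := h.exists_leftInvOn_mk_eq_iff (Λ := Λ)
    ((t.finite_gens.union t'.finite_gens).union (p.finite_gens.union q.finite_gens))
    ((hS.union hS').union (p.finite_idx.union q.finite_idx))
  have hpf : (p.map ι).map f = p := Term.map_map_eq_self (hf.mono (by grind))
  have hqf : (q.map ι).map f = q := Term.map_map_eq_self (hf.mono (by grind))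
  have hle {t r : Term J G} (ht : t.gens ⊆ _) (hr : r.gens ⊆ _)
      (hle : (Fr.mk t : Fr Λ ρ') ≤ Fr.mk r) : (Fr.mk (t.map f) : Fr Λ ρ) ≤ Fr.mk (r.map f) :=
    (hmk (.sup t r) r (Set.union_subset ht hr) hr).mpr hle
  refine ⟨Fr.mk (t.map f), ht f (hf.mono (by grind)), ?_, ?_, ?_⟩
  · rw [← (hmk t' t (by grind) (by grind)).mpr htt']
    exact ht' f (hf.mono (by grind))
  · rw [← hpf]
    exact hle (by grind [Term.gens_map]) (by grind) hx
  · rw [← hqf]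
    exact hle (r := .compl t) (by grind [Term.gens_map]) (by grind [Term.gens]) hy

theorem exists_mem_sg_mem_dimSet (h : IsDimExtension ι ρ ρ') {X : Set (Fr Λ ρ)} {x : Fr Λ ρ}
    (hx : x ∈ X) (hne : (dimSet I x).Nonempty) {j : J} (hj : j ∉ Set.range ι) :
    ∃ a ∈ sg J (h.embed '' X), j ∈ dimSet J a := by
  obtain ⟨i, hi⟩ := hne
  refine ⟨MSA.s j (ι i) (h.embed x), Sg.s _ _ _ (Sg.basic _ ⟨x, hx, rfl⟩), ?_⟩
  rw [← MSAHom.mem_dimSet_iff h.embed_injective] at hi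
  contrapose! hi
  have hjx : MSA.c j (h.embed x) = h.embed x :=
    notMem_dimSet.mp fun hjx => hj (h.dimSet_embed_subset x hjx)
  exact notMem_dimSet.mpr
    (c_eq_of_c_s_eq (fun hij => hj ⟨i, hij⟩) hjx (notMem_dimSet.mp hi))

end IsDimExtension

end FreeAlgebras

section BoxSuccessor

variable {A : Type v} [ModalAlgebra A] {S S' U V W F F' : Set A}

/-- The condition `□a ∈ U → a ∈ V` of the accessibility relation of canonical models, restricted
to the elements `a` of `S`. -/
def BoxSuccessor (S U V : Set A) : Prop :=
  ∀ a ∈ S, box a ∈ U → a ∈ V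

theorem boxSuccessor_preimage_compl_iff (hS : ∀ a, aᶜ ∈ S ↔ a ∈ S) :
    BoxSuccessor S (compl ⁻¹' F) (compl ⁻¹' F') ↔ ∀ b ∈ S, dia b ∈ F → b ∈ F' := by
  rw [BoxSuccessor, compl_surjective.forall]
  simp only [hS, Set.mem_preimage, compl_compl, dia]

theorem boxSuccessor_self (hT : ModalAxiom.T.Valid A) (hU : IsTheory S U) :
    BoxSuccessor S U U :=
  fun a ha hbox => hU.mem_of_le hbox (box_le_self hT a) ha

theorem BoxSuccessor.trans (hUV : BoxSuccessor S U V) (hVW : BoxSuccessor S' V W)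
    (h4 : ModalAxiom.four.Valid A) (hU : IsTheory S U) (hS : ∀ a ∈ S, box a ∈ S)
    (hSS' : S ⊆ S') : BoxSuccessor S U W := fun a ha hbox =>
  hVW a (hSS' ha) (hUV _ (hS a ha)
    (hU.mem_of_le hbox (box_le_box_box h4 a) (hS _ (hS a ha))))

theorem BoxSuccessor.image {I J K : Type u} {ι : I → J} {κ : I → K} {μ : J → K} {B C : Type v}
    [MSA I A] [ModalAlgebra B] [MSA J B] [ModalAlgebra C] [MSA K C] {e : MSAHom ι A B}
    {d : MSAHom κ A C} {d' : MSAHom μ B C} (hd : Function.Injective d)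
    (hde : ∀ x, d' (e x) = d x) {V : Set B} (h : BoxSuccessor S U (e ⁻¹' V)) :
    BoxSuccessor (d '' S) (d '' U) (d' '' V) := by
  rintro _ ⟨a, ha, rfl⟩ hbox
  rw [← d.map_box, hd.mem_set_image] at hbox
  exact ⟨e a, h a ha hbox, hde a⟩

end BoxSuccessor

section Successor

variable {I J G : Type u} {Λ : Set ModalAxiom} {ρ : G → Set I} {ρ' : G → Set J} {ι : I → J}
  {X X₁ X₂ T F : Set (Fr Λ ρ)}

namespace IsDimExtension

theorem isFreshBase_image_box (h : IsDimExtension ι ρ ρ') (hT : IsTheory (sg I X) T) :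
    IsFreshBase (Set.range ι)ᶜ (h.embed '' X) (h.embed '' {a ∈ sg I X | box a ∈ T}) where
  subset_sg := Set.image_subset_iff.mpr fun _ ha => MSAHom.map_mem_sg ha.1
  top_mem := by
    have hbox : box (⊤ : Fr Λ ρ) = ⊤ := ModalAlgebra.box_top
    exact ⟨⊤, ⟨Sg.top, hbox.symm ▸ hT.top_mem Sg.top⟩, map_top _⟩
  infClosed := by
    rintro _ ⟨a, ⟨ha, haT⟩, rfl⟩ _ ⟨b, ⟨hb, hbT⟩, rfl⟩
    have hab : box a ⊓ box b ∈ T := hT.inf_mem haT hbT (ha.box.inf _ _ hb.box)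
    exact ⟨a ⊓ b, ⟨ha.inf _ _ hb, hT.mem_of_le hab (box_inf_box_le a b) (ha.inf _ _ hb).box⟩,
      map_inf _ a b⟩
  disjoint_dimSet := Set.forall_mem_image.mpr fun a _ =>
    disjoint_compl_right.mono_left (h.dimSet_embed_subset a)

theorem inseparable_image_box (h : IsDimExtension ι ρ ρ') (hD : ModalAxiom.D.Valid (Fr Λ ρ))
    (hTF : Saturated I X₁ X₂ T F) :
    Inseparable J (h.embed '' X₁) (h.embed '' X₂) (h.embed '' {a ∈ sg I X₁ | box a ∈ T})
      (h.embed '' {a ∈ sg I X₂ | box a ∈ compl ⁻¹' F}) ⊤ ⊤ := by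
  obtain ⟨hT, hF, hdisj⟩ := saturated_iff.mp hTF
  rintro _ ⟨a, ⟨-, haT⟩, rfl⟩ _ ⟨b, ⟨-, hbF⟩, rfl⟩ z hz₁ hz₂ haz hbz
  rw [inf_top_eq] at haz hbz
  obtain ⟨w, hw₁, hw₂, haw, hbw⟩ := h.exists_separator hz₁ hz₂ haz hbz
  have hwT : box w ∈ T := hT.theory.mem_of_le haT (box_mono haw) hw₁.box
  have hbw' : box b ≤ (box w)ᶜ := (box_mono hbw).trans (le_compl_comm.mp (box_le_dia hD w))
  have hwF : (box w)ᶜ ∈ compl ⁻¹' F := hF.theory.mem_of_le hbF hbw' hw₂.box.compl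
  rw [Set.mem_preimage, compl_compl] at hwF
  exact Set.disjoint_left.mp hdisj hwT hwF

theorem exists_saturated_boxSuccessor [Countable J] [Countable G] (h : IsDimExtension ι ρ ρ')
    (hJ : (Set.range ι)ᶜ.Infinite) (hD : ModalAxiom.D.Valid (Fr Λ ρ))
    (hTF : Saturated I X₁ X₂ T F) :
    ∃ T' F', Saturated J (h.embed '' X₁) (h.embed '' X₂) T' F' ∧
      BoxSuccessor (sg I X₁) T (h.embed ⁻¹' T') ∧
      BoxSuccessor (sg I X₂) (compl ⁻¹' F) (h.embed ⁻¹' (compl ⁻¹' F')) := by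
  obtain ⟨hT, hF, -⟩ := saturated_iff.mp hTF
  obtain ⟨T', U', hT', hU', hTU', hTT', hFU'⟩ := exists_saturatedTheory_pair hJ
    h.finite_dimSet_inter (h.isFreshBase_image_box hT.theory) (h.isFreshBase_image_box hF.theory)
    (h.inseparable_image_box hD hTF)
  have hUU' : compl ⁻¹' (compl ⁻¹' U') = U' := compl_involutive.leftInverse.preimage_preimage U'
  refine ⟨T', compl ⁻¹' U', saturated_iff.mpr ⟨hT', hUU'.symm ▸ hU', Set.disjoint_left.mpr hTU'⟩,
    fun a ha hbox => hTT' ⟨a, ⟨ha, hbox⟩, rfl⟩, fun a ha hbox => ?_⟩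
  rw [hUU']
  exact hFU' ⟨a, ⟨ha, hbox⟩, rfl⟩

end IsDimExtension

end Successor

section Levels

open Ordinal

variable {α β : Ordinal.{u}} {Λ : Set ModalAxiom} {ρ : Set.Iio β → Set (Set.Iio α)}

theorem countable_Iio_omega0_mul_omega0 : (Set.Iio (ω * ω : Ordinal.{u})).Countable := by
  rw [← Cardinal.le_aleph0_iff_set_countable, Cardinal.mk_Iio_ordinal]
  simp only [card_mul, card_omega0, Cardinal.aleph0_mul_aleph0, Cardinal.lift_aleph0, le_refl]

theorem countable_Iio_dimN [Countable (Set.Iio α)] (n : ℕ) :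
    Countable (Set.Iio (dimN α n)) := by
  have hα := Cardinal.mk_le_aleph0 (α := Set.Iio α)
  rw [Cardinal.mk_Iio_ordinal, Cardinal.lift_le_aleph0] at hα
  rw [← Cardinal.mk_le_aleph0_iff, Cardinal.mk_Iio_ordinal, Cardinal.lift_le_aleph0, dimN,
    card_add, card_mul, card_nat, card_omega0]
  refine Cardinal.add_le_aleph0.mpr ⟨hα, (mul_le_mul' le_rfl Cardinal.natCast_le_aleph0).trans ?_⟩
  rw [Cardinal.aleph0_mul_aleph0]

theorem dimN_succ (α : Ordinal.{u}) (n : ℕ) : dimN α (n + 1) = dimN α n + ω := by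
  rw [dimN, dimN, add_assoc, Nat.cast_succ, mul_add_one]

theorem dimN_strictMono (α : Ordinal.{u}) : StrictMono (dimN α) :=
  strictMono_nat_of_lt_succ fun n => by
    rw [dimN_succ]
    exact lt_add_of_pos_right _ omega0_pos

theorem infinite_compl_range_inclusion (α : Ordinal.{u}) (n : ℕ) :
    (Set.range (Set.inclusion (Set.Iio_subset_Iio (dimN_mono α n.le_succ))))ᶜ.Infinite := by
  have hlt (r : ℕ) : dimN α n + r < dimN α (n + 1) := by
    rw [dimN_succ]
    exact add_lt_add_right (natCast_lt_omega0 r) _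
  refine Set.infinite_of_injective_forall_mem
    (f := fun r : ℕ => (⟨dimN α n + r, hlt r⟩ : Set.Iio (dimN α (n + 1)))) (fun r s hrs => ?_) ?_
  · exact Nat.cast_injective (add_left_cancel (congrArg Subtype.val hrs))
  · rintro r ⟨j, hj⟩
    have hjr : j.1 = dimN α n + r := congrArg Subtype.val hj
    exact (hjr ▸ Set.mem_Iio.mp j.2).not_ge le_self_add

theorem embed_embed {γ δ ε : Ordinal.{u}} (h : γ ≤ δ) (h' : δ ≤ ε)
    (H : IsDimExtension (Set.inclusion (Set.Iio_subset_Iio h)) (extendRestr ρ γ)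
      (extendRestr ρ δ))
    (H' : IsDimExtension (Set.inclusion (Set.Iio_subset_Iio h')) (extendRestr ρ δ)
      (extendRestr ρ ε))
    (H'' : IsDimExtension (Set.inclusion (Set.Iio_subset_Iio (h.trans h'))) (extendRestr ρ γ)
      (extendRestr ρ ε)) (x : FrDim Λ ρ γ) : H'.embed (H.embed x) = H''.embed x := by
  obtain ⟨t, rfl⟩ := Fr.exists_mk_eq x
  rw [IsDimExtension.embed_mk, IsDimExtension.embed_mk, IsDimExtension.embed_mk, Term.map_map]
  rfl

theorem push_eq_image {γ δ : Ordinal.{u}} {h : γ ≤ δ}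
    (H : IsDimExtension (Set.inclusion (Set.Iio_subset_Iio h)) (extendRestr ρ γ)
      (extendRestr ρ δ)) (X : Set (FrDim Λ ρ γ)) : push h X = H.embed '' X := by
  ext y
  constructor
  · rintro ⟨t, ht, rfl⟩
    exact ⟨_, ht, rfl⟩
  · rintro ⟨x, hx, rfl⟩
    obtain ⟨t, rfl⟩ := Fr.exists_mk_eq x
    exact ⟨t, hx, rfl⟩

/-- `U ⊆ B_∞` is a saturated theory in the subalgebra of `B_n` generated by `X`, where `B_n` is
identified with its image in `B_∞`. -/
def SaturatedTheoryAt (X : Set (FrDim Λ ρ α)) (n : ℕ) (U : Set (FrDim Λ ρ (α + ω * ω))) : Prop :=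
  ∃ T : Set (FrDim Λ ρ (dimN α n)),
    SaturatedTheory (Set.Iio (dimN α n)) (push (le_dimN α n) X) T ∧ U = push (dimN_le α n) T

variable (hρ : ∀ Γ : Finset (Set.Iio β), (⋃ η ∈ Γ, ρ η)ᶜ.Infinite)

include hρ

theorem isDimExtension_inclusion {γ δ : Ordinal.{u}} (hα : α ≤ γ) (h : γ ≤ δ)
    (hδ : δ ≤ α + ω * ω) :
    IsDimExtension (Set.inclusion (Set.Iio_subset_Iio h)) (extendRestr ρ γ)
      (extendRestr ρ δ) where
  inj := Set.inclusion_injective _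
  countable := by
    have hcount := countable_Iio_omega0_mul_omega0.image fun x => α + x
    refine Set.MapsTo.countable_of_injOn (f := fun j : Set.Iio δ => j.1) (fun j hj => ?_)
      Subtype.val_injective.injOn hcount
    have hαj : α ≤ j.1 := by
      by_contra! hlt
      exact hj ⟨⟨j.1, hlt.trans_le hα⟩, rfl⟩
    refine ⟨j.1 - α, ?_, Ordinal.add_sub_cancel_of_le hαj⟩
    rw [Set.mem_Iio, ← add_lt_add_iff_left α, Ordinal.add_sub_cancel_of_le hαj]
    exact lt_of_lt_of_le j.2 hδ
  restr g := by
    ext j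
    constructor
    · rintro ⟨i, hi, hij⟩
      exact ⟨⟨i.1, lt_of_lt_of_le i.2 hα⟩, ⟨i, hi, rfl⟩, Subtype.ext hij⟩
    · rintro ⟨k, ⟨i, hi, hik⟩, rfl⟩
      exact ⟨i, hi, hik⟩
  infinite Γ hΓ := by
    refine ((hρ hΓ.toFinset).image
      (Set.inclusion_injective (Set.Iio_subset_Iio hα)).injOn).mono ?_
    rintro _ ⟨i, hi, rfl⟩ hi'
    obtain ⟨g, hg, k, hk, hki⟩ := Set.mem_iUnion₂.mp hi'
    exact hi (Set.mem_iUnion₂.mpr ⟨g, hΓ.mem_toFinset.mpr hg, Subtype.ext hki ▸ hk⟩)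

theorem isDimExtension_base (n : ℕ) :
    IsDimExtension (Set.inclusion (Set.Iio_subset_Iio (le_dimN α n))) (extendRestr ρ α)
      (extendRestr ρ (dimN α n)) :=
  isDimExtension_inclusion hρ le_rfl (le_dimN α n) (dimN_le α n)

theorem isDimExtension_level {n m : ℕ} (h : n ≤ m) :
    IsDimExtension (Set.inclusion (Set.Iio_subset_Iio (dimN_mono α h)))
      (extendRestr ρ (dimN α n)) (extendRestr ρ (dimN α m)) :=
  isDimExtension_inclusion hρ (le_dimN α n) (dimN_mono α h) (dimN_le α m)

theorem isDimExtension_limit (n : ℕ) :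
    IsDimExtension (Set.inclusion (Set.Iio_subset_Iio (dimN_le α n)))
      (extendRestr ρ (dimN α n)) (extendRestr ρ (α + ω * ω)) :=
  isDimExtension_inclusion hρ (le_dimN α n) (dimN_le α n) le_rfl

theorem valid_limit {φ : ModalAxiom} (hφ : φ.Valid (FrDim Λ ρ α)) :
    φ.Valid (FrDim Λ ρ (α + ω * ω)) :=
  (isDimExtension_limit hρ 0).valid ((isDimExtension_base hρ 0).valid hφ)

theorem push_limit_image_level {n m : ℕ} (h : n ≤ m) (T : Set (FrDim Λ ρ (dimN α n))) :
    push (dimN_le α m) ((isDimExtension_level hρ h).embed '' T) = push (dimN_le α n) T := by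
  rw [push_eq_image (isDimExtension_limit hρ m), push_eq_image (isDimExtension_limit hρ n),
    Set.image_image]
  exact Set.image_congr fun x _ => embed_embed (dimN_mono α h) (dimN_le α m) _ _ _ x

section

variable (X : Set (FrDim Λ ρ α))

theorem image_level_push {n m : ℕ} (h : n ≤ m) :
    (isDimExtension_level hρ h).embed '' push (le_dimN α n) X = push (le_dimN α m) X := by
  rw [push_eq_image (isDimExtension_base hρ n), push_eq_image (isDimExtension_base hρ m),
    Set.image_image]
  exact Set.image_congr fun x _ => embed_embed (le_dimN α n) (dimN_mono α h) _ _ _ x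

theorem push_sgN_mono : Monotone fun n => push (dimN_le α n) (sgN n X) := by
  intro n m h
  simp only [← push_limit_image_level hρ h, push_eq_image (isDimExtension_limit hρ m)]
  refine Set.image_mono (Set.image_subset_iff.mpr fun a ha => ?_)
  rw [Set.mem_preimage, sgN, ← image_level_push hρ X h]
  exact MSAHom.map_mem_sg ha

variable {X}

theorem compl_mem_push_sgN_iff {n : ℕ} (a : FrDim Λ ρ (α + ω * ω)) :
    aᶜ ∈ push (dimN_le α n) (sgN n X) ↔ a ∈ push (dimN_le α n) (sgN n X) := by
  have hsg : compl ⁻¹' sgN n X = sgN n X := Set.ext fun _ => compl_mem_sg_iff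
  rw [push_eq_image (isDimExtension_limit hρ n), ← Set.mem_preimage (f := compl),
    ← MSAHom.image_preimage_compl, hsg]

theorem box_mem_push_sgN {n : ℕ} (a : FrDim Λ ρ (α + ω * ω))
    (ha : a ∈ push (dimN_le α n) (sgN n X)) : box a ∈ push (dimN_le α n) (sgN n X) := by
  rw [push_eq_image (isDimExtension_limit hρ n)] at ha ⊢
  obtain ⟨a, ha, rfl⟩ := ha
  exact ⟨box a, Sg.box a ha, MSAHom.map_box _ a⟩

end

namespace SaturatedTheoryAt

variable {X : Set (FrDim Λ ρ α)} {U : Set (FrDim Λ ρ (α + ω * ω))}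

theorem isTheory {n : ℕ} (hU : SaturatedTheoryAt X n U) :
    IsTheory (push (dimN_le α n) (sgN n X)) U := by
  obtain ⟨T, hT, rfl⟩ := hU
  rw [push_eq_image (isDimExtension_limit hρ n), push_eq_image (isDimExtension_limit hρ n)]
  exact MSAHom.isTheory_image (isDimExtension_limit hρ n).embed_injective hT.theory Sg.top
    fun _ ha _ hb => Sg.inf _ _ ha hb

theorem dimSet_eq_empty {k m : ℕ} (hkm : k < m) (hk : SaturatedTheoryAt X k U)
    (hm : SaturatedTheoryAt X m U) : ∀ x ∈ X, dimSet (Set.Iio α) x = ∅ := by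
  intro x hx
  by_contra! hne
  let j : Set.Iio (dimN α m) := ⟨dimN α k, dimN_strictMono α hkm⟩
  obtain ⟨a, ha, hja⟩ := (isDimExtension_base hρ m).exists_mem_sg_mem_dimSet hx hne (j := j)
    fun ⟨i, hi⟩ => (lt_of_lt_of_le i.2 (le_dimN α k)).ne (congrArg Subtype.val hi)
  rw [← push_eq_image (h := le_dimN α m)] at ha
  obtain ⟨T, -, hTU⟩ := hk
  obtain ⟨T', hT', rfl⟩ := hm
  rw [push_eq_image (isDimExtension_limit hρ m), push_eq_image (isDimExtension_limit hρ k)] at hTU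
  have hnotMem : ∀ b ∈ T', j ∉ dimSet _ b := by
    intro b hb hjb
    obtain ⟨c, -, hc⟩ := hTU.le ⟨b, hb, rfl⟩
    rw [← MSAHom.mem_dimSet_iff (isDimExtension_limit hρ m).embed_injective, ← hc] at hjb
    obtain ⟨i, hi⟩ := (isDimExtension_limit hρ k).dimSet_embed_subset c hjb
    exact i.2.ne (congrArg Subtype.val hi)
  rcases hT'.mem_or_compl_mem ha with haT | haT
  · exact hnotMem a haT hja
  · exact hnotMem aᶜ haT (by rwa [dimSet_compl])

theorem zero {n : ℕ} (hX : ∀ x ∈ X, dimSet (Set.Iio α) x = ∅) (hU : SaturatedTheoryAt X n U) :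
    SaturatedTheoryAt X 0 U := by
  obtain ⟨T, hT, rfl⟩ := hU
  let e := (isDimExtension_level hρ n.zero_le).embed (Λ := Λ)
  have := (isDimExtension_level hρ n.zero_le).infinite_domain
  have := (isDimExtension_level hρ n.zero_le).infinite_codomain
  have hX₀ : ∀ x ∈ push (le_dimN α 0) X, dimSet (Set.Iio (dimN α 0)) x = ∅ := by
    rw [push_eq_image (isDimExtension_base hρ 0), Set.forall_mem_image]
    intro x hx
    rw [IsDimExtension.dimSet_embed, hX x hx, Set.image_empty]
  rw [← image_level_push hρ X n.zero_le] at hT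
  have hTe : T ⊆ e '' sgN 0 X := hT.theory.1.trans <|
    MSAHom.sg_image_subset_of_dimSet_eq_empty fun x hx => by
      rw [IsDimExtension.dimSet_embed, hX₀ x hx, Set.image_empty]
  refine ⟨e ⁻¹' T, MSAHom.saturatedTheory_preimage_of_dimSet_eq_empty
    (isDimExtension_level hρ n.zero_le).embed_injective hX₀ hTe hT, ?_⟩
  rw [← push_limit_image_level hρ n.zero_le,
    Set.image_preimage_eq_of_subset (hTe.trans (Set.image_subset_range _ _))]

end SaturatedTheoryAt

variable {X₁ X₂ : Set (FrDim Λ ρ α)}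

theorem saturatedAt_iff {n : ℕ}
    {w : Set (FrDim Λ ρ (α + ω * ω)) × Set (FrDim Λ ρ (α + ω * ω))} :
    SaturatedAt X₁ X₂ n w ↔ SaturatedTheoryAt X₁ n w.1 ∧
      SaturatedTheoryAt X₂ n (compl ⁻¹' w.2) ∧ Disjoint w.1 w.2 := by
  have hinj := (isDimExtension_limit hρ n).embed_injective (Λ := Λ)
  have hpush (F : Set (FrDim Λ ρ (dimN α n))) :
      push (dimN_le α n) (compl ⁻¹' F) = compl ⁻¹' push (dimN_le α n) F := by
    rw [push_eq_image (isDimExtension_limit hρ n), push_eq_image (isDimExtension_limit hρ n),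
      MSAHom.image_preimage_compl]
  obtain ⟨U, V⟩ := w
  constructor
  · rintro ⟨T, F, hTF, rfl, rfl⟩
    obtain ⟨hT, hF, hdisj⟩ := saturated_iff.mp hTF
    refine ⟨⟨T, hT, rfl⟩, ⟨_, hF, (hpush F).symm⟩, ?_⟩
    rw [push_eq_image (isDimExtension_limit hρ n), push_eq_image (isDimExtension_limit hρ n)]
    exact (Set.disjoint_image_iff hinj).mpr hdisj
  · rintro ⟨⟨T, hT, rfl⟩, ⟨F, hF, hV⟩, hdisj⟩
    have hVF : V = push (dimN_le α n) (compl ⁻¹' F) := by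
      rw [hpush, ← hV, compl_involutive.leftInverse.preimage_preimage]
    refine ⟨T, compl ⁻¹' F, saturated_iff.mpr ⟨hT, ?_, ?_⟩, rfl, hVF⟩
    · rwa [compl_involutive.leftInverse.preimage_preimage]
    · rw [hVF, push_eq_image (isDimExtension_limit hρ n),
        push_eq_image (isDimExtension_limit hρ n)] at hdisj
      exact (Set.disjoint_image_iff hinj).mp hdisj

namespace World

omit hρ in
theorem saturatedAt_level (w : World X₁ X₂) : SaturatedAt X₁ X₂ w.level w.1 :=
  Nat.sInf_mem w.2

theorem isTheory_fst (w : World X₁ X₂) :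
    IsTheory (push (dimN_le α w.level) (sgN w.level X₁)) w.1.1 :=
  ((saturatedAt_iff hρ).mp w.saturatedAt_level).1.isTheory hρ

theorem isTheory_preimage_compl_snd (w : World X₁ X₂) :
    IsTheory (push (dimN_le α w.level) (sgN w.level X₂)) (compl ⁻¹' w.1.2) :=
  ((saturatedAt_iff hρ).mp w.saturatedAt_level).2.1.isTheory hρ

theorem level_le_of_lt (w w' : World X₁ X₂) {m : ℕ} (hm : w.level < m)
    (hw' : SaturatedAt X₁ X₂ m w'.1) : w.level ≤ w'.level := by
  by_contra! hlt
  obtain ⟨hT, hF, -⟩ := (saturatedAt_iff hρ).mp w'.saturatedAt_level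
  obtain ⟨hTm, hFm, -⟩ := (saturatedAt_iff hρ).mp hw'
  obtain ⟨hT', hF', hdisj⟩ := (saturatedAt_iff hρ).mp w.saturatedAt_level
  have hzero : SaturatedAt X₁ X₂ 0 w.1 := (saturatedAt_iff hρ).mpr
    ⟨hT'.zero hρ (hT.dimSet_eq_empty hρ (hlt.trans hm) hTm),
      hF'.zero hρ (hF.dimSet_eq_empty hρ (hlt.trans hm) hFm), hdisj⟩
  exact (Nat.zero_le _).not_gt (hlt.trans_le (Nat.sInf_le hzero))

theorem acc_iff {w w' : World X₁ X₂} : w.Acc w' ↔ w.level ≤ w'.level ∧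
    BoxSuccessor (push (dimN_le α w.level) (sgN w.level X₁)) w.1.1 w'.1.1 ∧
    BoxSuccessor (push (dimN_le α w.level) (sgN w.level X₂)) (compl ⁻¹' w.1.2)
      (compl ⁻¹' w'.1.2) := by
  rw [boxSuccessor_preimage_compl_iff (compl_mem_push_sgN_iff hρ)]
  rfl

theorem acc_serial [Countable (Set.Iio α)] [Countable (Set.Iio β)]
    (hD : ModalAxiom.D.Valid (FrDim Λ ρ α)) (w : World X₁ X₂) : ∃ w', w.Acc w' := by
  obtain ⟨T, F, hTF, hwT, hwF⟩ := w.saturatedAt_level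
  let E := isDimExtension_limit hρ w.level
  let E' := isDimExtension_limit hρ (w.level + 1)
  have := countable_Iio_dimN (α := α) (w.level + 1)
  obtain ⟨T', F', hTF', hTT', hFF'⟩ :=
    (isDimExtension_level hρ w.level.le_succ).exists_saturated_boxSuccessor
      (infinite_compl_range_inclusion α w.level) ((isDimExtension_base hρ w.level).valid hD) hTF
  rw [image_level_push hρ X₁ w.level.le_succ, image_level_push hρ X₂ w.level.le_succ] at hTF'
  have hw' : SaturatedAt X₁ X₂ (w.level + 1) (push (dimN_le α _) T', push (dimN_le α _) F') :=
    ⟨T', F', hTF', rfl, rfl⟩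
  have htrans := embed_embed (Λ := Λ) (dimN_mono α w.level.le_succ) (dimN_le α _)
    (isDimExtension_level hρ w.level.le_succ) E' E
  refine ⟨⟨_, _, hw'⟩, (acc_iff hρ).mpr
    ⟨level_le_of_lt hρ _ _ w.level.lt_succ_self hw', ?_, ?_⟩⟩
  · change BoxSuccessor _ _ (push (dimN_le α _) T')
    rw [hwT, push_eq_image E, push_eq_image E, push_eq_image E']
    exact hTT'.image E.embed_injective htrans
  · change BoxSuccessor _ _ (compl ⁻¹' push (dimN_le α _) F')
    rw [hwF, push_eq_image E, push_eq_image E, push_eq_image E', ← MSAHom.image_preimage_compl,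
      ← MSAHom.image_preimage_compl]
    exact hFF'.image E.embed_injective htrans

theorem acc_refl (hT : ModalAxiom.T.Valid (FrDim Λ ρ α)) (w : World X₁ X₂) : w.Acc w :=
  (acc_iff hρ).mpr ⟨le_rfl, boxSuccessor_self (valid_limit hρ hT) (w.isTheory_fst hρ),
    boxSuccessor_self (valid_limit hρ hT) (w.isTheory_preimage_compl_snd hρ)⟩

theorem acc_trans (h4 : ModalAxiom.four.Valid (FrDim Λ ρ α)) {w₁ w₂ w₃ : World X₁ X₂}
    (h₁₂ : w₁.Acc w₂) (h₂₃ : w₂.Acc w₃) : w₁.Acc w₃ := by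
  obtain ⟨hle, hT, hF⟩ := (acc_iff hρ).mp h₁₂
  obtain ⟨hle', hT', hF'⟩ := (acc_iff hρ).mp h₂₃
  exact (acc_iff hρ).mpr ⟨hle.trans hle',
    hT.trans hT' (valid_limit hρ h4) (w₁.isTheory_fst hρ) (box_mem_push_sgN hρ)
      (push_sgN_mono hρ X₁ hle),
    hF.trans hF' (valid_limit hρ h4) (w₁.isTheory_preimage_compl_snd hρ) (box_mem_push_sgN hρ)
      (push_sgN_mono hρ X₂ hle)⟩

end World

end Levels

end QML

theorem mainTheorem2 {α β : Ordinal.{u}} (hα : Ordinal.omega0 ≤ α)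
    (Λ : Set QML.ModalAxiom) (ρ : Set.Iio β → Set (Set.Iio α))
    (hρ : ∀ Γ : Finset (Set.Iio β), (⋃ η ∈ Γ, ρ η)ᶜ.Infinite)
    (X₁ X₂ : Set (QML.FrDim Λ ρ α)) :
    (Countable (Set.Iio α) → Countable (Set.Iio β) →
      QML.dia (⊤ : QML.FrDim Λ ρ α) = ⊤ →
        ∀ x, ∃ y, (QML.canonicalKripke X₁ X₂ hα).Rel x y) ∧
    ((∀ p : QML.FrDim Λ ρ α, (QML.box p)ᶜ ⊔ p = ⊤) →
        ∀ x, (QML.canonicalKripke X₁ X₂ hα).Rel x x) ∧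
    ((∀ p : QML.FrDim Λ ρ α, (QML.box p)ᶜ ⊔ QML.box (QML.box p) = ⊤) →
        ∀ x y z, (QML.canonicalKripke X₁ X₂ hα).Rel x y →
          (QML.canonicalKripke X₁ X₂ hα).Rel y z → (QML.canonicalKripke X₁ X₂ hα).Rel x z) ∧
    (Countable (Set.Iio α) → Countable (Set.Iio β) → QML.ModalAxiom.D ∈ Λ →
        ∀ x, ∃ y, (QML.canonicalKripke X₁ X₂ hα).Rel x y) ∧
    (QML.ModalAxiom.T ∈ Λ → ∀ x, (QML.canonicalKripke X₁ X₂ hα).Rel x x) ∧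
    (QML.ModalAxiom.four ∈ Λ →
        ∀ x y z, (QML.canonicalKripke X₁ X₂ hα).Rel x y →
          (QML.canonicalKripke X₁ X₂ hα).Rel y z → (QML.canonicalKripke X₁ X₂ hα).Rel x z) := by
  have serial (h₁ : Countable (Set.Iio α)) (h₂ : Countable (Set.Iio β))
      (hD : QML.ModalAxiom.D.Valid (QML.FrDim Λ ρ α)) :
      ∀ x, ∃ y, (QML.canonicalKripke X₁ X₂ hα).Rel x y := QML.World.acc_serial hρ hD
  have refl (hT : QML.ModalAxiom.T.Valid (QML.FrDim Λ ρ α)) :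
      ∀ x, (QML.canonicalKripke X₁ X₂ hα).Rel x x := QML.World.acc_refl hρ hT
  have trans (h4 : QML.ModalAxiom.four.Valid (QML.FrDim Λ ρ α)) :
      ∀ x y z, (QML.canonicalKripke X₁ X₂ hα).Rel x y →
        (QML.canonicalKripke X₁ X₂ hα).Rel y z → (QML.canonicalKripke X₁ X₂ hα).Rel x z :=
    fun _ _ _ => QML.World.acc_trans hρ h4
  exact ⟨serial, refl, trans, fun h₁ h₂ hD => serial h₁ h₂ (QML.Fr.valid hD),
    fun hT => refl (QML.Fr.valid hT), fun h4 => trans (QML.Fr.valid h4)⟩
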